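/- Hypergraphs are finite, undirected and without repeated edges: a nonempty finite vertex set $V$ and a set $E$ of subsets of $V$, each with at least two elements. A hypergraph is $k$-uniform if all its edges have $k$ elements, and connected if any two vertices are joined by a finite chain of vertices in which consecutive vertices lie in a common edge. A connected $k$-uniform hypergraph with $n$ vertices and $m$ edges is unicyclic if $n-1=(k-1)m-1$. The adjacency matrix of $G=(V,E)$ has zero diagonal and, for $u\neq v$, the entry $\sum_{e\in E,\ u,v\in e}\frac{1}{|e|-1}$ at $(u,v)$; the spectral radius $\rho(G)$ is the maximum modulus of its eigenvalues. An isomorphism $G\cong H$ is a bijection of the vertex sets that induces a bijection of the edge sets. Let $k\ge 3$ and $n$ be natural numbers. The 2-hypercycle $\mathbb C$ is the $k$-uniform hypergraph on $2k-2$ vertices with exactly two edges $e_1,e_2$, where $e_1\cap e_2=\{v_1,v_2\}$. Attaching a pendant edge at a vertex $v$ means adding $k-1$ new vertices and the edge consisting of them and $v$. For $(k-1)\mid n$ and $\frac{n}{k-1}\ge 4$, let $\mathscr U^*$ be obtained from $\mathbb C$ by attaching $\frac{n}{k-1}-2$ pendant edges at $v_1$, and let $\mathcal F$ be obtained from $\mathbb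 C$ by attaching $\frac{n}{k-1}-3$ pendant edges at $v_1$ and one pendant edge at $v_2$. Let $\Lambda$ be the class of $k$-uniform unicyclic hypergraphs on $n$ vertices with at least $4$ edges that are not isomorphic to $\mathscr U^*$ (every unicyclic hypergraph on $n$ vertices has exactly $\frac{n}{k-1}$ edges, so $\Lambda$ is empty unless $(k-1)\mid n$ and $\frac{n}{k-1}\ge 4$). **Theorem.** For every $G\in\Lambda$ we have $\rho(G)\le\rho(\mathcal F)$, with equality if and only if $G\cong\mathcal F$. Moreover, if $(k-1)\mid n$ and $\frac{n}{k-1}\ge 4$, then $\mathcal F\in\Lambda$, $\mathscr U^*$ is a $k$-uniform unicyclic hypergraph on $n$ vertices, and $\rho(\mathcal F)<\rho(\mathscr U^*)$; so $\mathcal F$ has the second-largest spectral radius among the $k$-uniform unicyclic hypergraphs on $n$ vertices. -/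

import Mathlib

/-- A finite hypergraph without repeated edges on the vertex type `V` (used with `V` finite):
a finite set of edges, each edge being a set of at least two vertices. -/
structure FinHypergraph (V : Type*) where
  /-- The set of edges. -/
  edges : Finset (Finset V)
  two_le_card : ∀ e ∈ edges, 2 ≤ e.card

namespace FinHypergraph

/-- Every edge has exactly `k` vertices. -/
def IsUniform {V : Type*} (G : FinHypergraph V) (k : ℕ) : Prop :=
  ∀ e ∈ G.edges, e.card = k

/-- Two vertices are adjacent if some edge contains both of them. -/
def Adj {V : Type*} (G : FinHypergraph V) (u v : V) : Prop :=
  ∃ e ∈ G.edges, u ∈ e ∧ v ∈ e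

/-- Connectedness: there is a vertex, and any two vertices are joined by a finite chain of
successively adjacent vertices. -/
def IsConnected {V : Type*} (G : FinHypergraph V) : Prop :=
  Nonempty V ∧ ∀ u v : V, Relation.ReflTransGen G.Adj u v

/-- A connected `k`-uniform hypergraph with `n` vertices and `m` edges is `r`-cyclic if
`n - 1 = (k - 1) m - r`. -/
def IsCyclic {V : Type*} [Fintype V] (G : FinHypergraph V) (k r : ℕ) : Prop :=
  G.IsConnected ∧ G.IsUniform k ∧
    (Fintype.card V : ℤ) - 1 = ((k : ℤ) - 1) * (G.edges.card : ℤ) - (r : ℤ)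

/-- `k`-uniform unicyclic hypergraphs are the `1`-cyclic ones. -/
def IsUnicyclic {V : Type*} [Fintype V] (G : FinHypergraph V) (k : ℕ) : Prop :=
  G.IsCyclic k 1

/-- Isomorphism: a bijection of the vertices which carries edges exactly to edges. -/
def Isomorphic {V W : Type*} (G : FinHypergraph V) (H : FinHypergraph W) : Prop :=
  ∃ f : V ≃ W, ∀ e : Finset V, e ∈ G.edges ↔ e.map f.toEmbedding ∈ H.edges

/-- The adjacency matrix: the entry at two distinct vertices `u`, `v` is the sum of
`1 / (|e| - 1)` over the edges `e` containing both; diagonal entries are zero. -/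
noncomputable def adjMatrix {V : Type*} [DecidableEq V] (G : FinHypergraph V) : Matrix V V ℝ :=
  Matrix.of fun u v =>
    if u = v then 0 else ∑ e ∈ G.edges with u ∈ e ∧ v ∈ e, 1 / ((e.card : ℝ) - 1)

/-- The spectral radius: the maximum modulus of the complex eigenvalues of the adjacency
matrix. -/
noncomputable def rho {V : Type*} [Fintype V] [DecidableEq V] (G : FinHypergraph V) : ℝ :=
  (spectralRadius ℂ (G.adjMatrix.map (fun x : ℝ => (x : ℂ)))).toReal

/-- The `k`-uniform hypercycle of length two. Its two edges share exactly the vertices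
`v₁ = inl 0` and `v₂ = inl 1`; the edge number `i` has `k - 2` further vertices `inr (i, j)`. -/
def twoCycle (k : ℕ) : FinHypergraph (Fin 2 ⊕ Fin 2 × Fin (k - 2)) where
  edges := Finset.univ.image fun i : Fin 2 =>
    {Sum.inl 0, Sum.inl 1} ∪ Finset.univ.image fun j : Fin (k - 2) => Sum.inr (i, j)
  two_le_card := by
    intro e he
    obtain ⟨i, -, rfl⟩ := Finset.mem_image.1 he
    refine le_trans (le_of_eq ?_) (Finset.card_le_card Finset.subset_union_left)
    rw [Finset.card_pair]
    simp

/-- The hypergraph obtained from `G` by attaching, for each `i : ι`, a pendant edge of size `k`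
at the vertex `a i`, consisting of `a i` and the `k - 1` new vertices `inr (i, j)`. -/
def attach {V ι : Type*} [DecidableEq V] [Fintype ι] [DecidableEq ι] (k : ℕ) (hk : 3 ≤ k)
    (G : FinHypergraph V) (a : ι → V) : FinHypergraph (V ⊕ ι × Fin (k - 1)) where
  edges := (G.edges.image fun e => e.image Sum.inl) ∪
    Finset.univ.image fun i : ι =>
      insert (Sum.inl (a i)) (Finset.univ.image fun j : Fin (k - 1) => Sum.inr (i, j))
  two_le_card := by
    intro e he
    rcases Finset.mem_union.1 he with h | h
    · obtain ⟨e', he', rfl⟩ := Finset.mem_image.1 h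
      rw [Finset.card_image_of_injective _ Sum.inl_injective]
      exact G.two_le_card e' he'
    · obtain ⟨i, -, rfl⟩ := Finset.mem_image.1 h
      rw [Finset.card_insert_of_notMem (by simp), Finset.card_image_of_injective]
      · simp only [Finset.card_univ, Fintype.card_fin]
        omega
      · intro x y h
        simpa using h

/-- `U*`: the hypercycle of length two with `n / (k - 1) - 2` pendant edges at `v₁`. -/
def uStar (k n : ℕ) (hk : 3 ≤ k) :
    FinHypergraph ((Fin 2 ⊕ Fin 2 × Fin (k - 2)) ⊕ Fin (n / (k - 1) - 2) × Fin (k - 1)) :=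
  attach k hk (twoCycle k) fun _ => Sum.inl 0

/-- `F`: the hypercycle of length two with `n / (k - 1) - 3` pendant edges at `v₁` and one
pendant edge at `v₂`. -/
def hyperF (k n : ℕ) (hk : 3 ≤ k) :
    FinHypergraph ((Fin 2 ⊕ Fin 2 × Fin (k - 2)) ⊕
      (Fin (n / (k - 1) - 3) ⊕ Fin 1) × Fin (k - 1)) :=
  attach k hk (twoCycle k) (Sum.elim (fun _ => Sum.inl 0) (fun _ => Sum.inl 1))

/-- The class `Λ`: the `k`-uniform unicyclic hypergraphs of order `n` with at least four edges
that are not isomorphic to `U*`. -/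
def MemLambda {V : Type*} [Fintype V] (G : FinHypergraph V) (k n : ℕ) (hk : 3 ≤ k) : Prop :=
  G.IsUnicyclic k ∧ Fintype.card V = n ∧ 4 ≤ G.edges.card ∧ ¬ G.Isomorphic (uStar k n hk)

end FinHypergraph

/-! Let `x` be a Perron vector of a unicyclic `G` and root `G` at a vertex `w` where `x` is largest.
Each edge `e` gets a parent `p e`, its vertex nearest to `w`. The m edges have (k-1)m = n non-parent
vertices in all, counted with multiplicity, and these cover the n-1 vertices other than `w`; so
exactly one vertex `z` is covered twice, by `e₁` and `e₂` (`IsUnicyclic.exists_rootedAt`).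

Replacing a vertex of an edge by one with at least as large an entry of `x` does not lower the
quadratic form at `x`. If the form does not drop and some row of the adjacency operator applied to
`x` strictly grows, the spectral radius strictly grows (`rho_lt_rho_of_edgeForm_le`). Replacing
every parent by `w` yields U*. To reach F, one edge `f` with `p f ≠ w` is kept while all others move
to `w`, and one further replacement, chosen by comparing `x z` with `x (p f)`, makes `f` hang at the
second vertex of the 2-cycle (`RootedAt.rho_lt_hyperF_of_move`).

One configuration resists this: a 2-cycle whose edges meet in two vertices other than `w`, with all
remaining edges through `w`. There two simultaneous replacements, one of which may lose weight, give
F (`rho_lt_hyperF_of_root_notMem`). Equality survives only when `G` already is F. -/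

/-! ### Rayleigh quotients and Perron vectors of symmetric matrices. -/

open Matrix in
open scoped Matrix.Norms.L2Operator in
theorem Matrix.IsSymm.dotProduct_mulVec_le_spectralRadius {V : Type*} [Fintype V] [DecidableEq V]
    {A : Matrix V V ℝ} (hA : A.IsSymm) (y : V → ℝ) :
    y ⬝ᵥ A *ᵥ y ≤
      (spectralRadius ℂ (A.map (fun x : ℝ => (x : ℂ)))).toReal * (y ⬝ᵥ y) := by
  set B : Matrix V V ℂ := A.map (fun x : ℝ => (x : ℂ)) with hB
  have hsa : IsSelfAdjoint B := by
    ext i j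
    simp [hB, Matrix.star_apply, hA.apply i j]
  -- For a self-adjoint matrix the spectral radius is the operator norm, so Cauchy–Schwarz suffices.
  rw [hsa.toReal_spectralRadius_complex_eq_norm]
  set Y : EuclideanSpace ℂ V := WithLp.toLp 2 (fun i => (y i : ℂ)) with hY
  have h1 : ‖inner ℂ Y (toEuclideanCLM (n := V) (𝕜 := ℂ) B Y)‖ ≤ ‖B‖ * (‖Y‖ * ‖Y‖) := by
    refine (norm_inner_le_norm _ _).trans ?_
    have := (toEuclideanCLM (n := V) (𝕜 := ℂ) B).le_opNorm Y
    rw [← cstar_norm_def] at this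
    nlinarith [norm_nonneg Y]
  have h2 : inner ℂ Y (toEuclideanCLM (n := V) (𝕜 := ℂ) B Y) = ((y ⬝ᵥ A *ᵥ y : ℝ) : ℂ) := by
    simp [hY, hB, toEuclideanCLM_toLp, PiLp.inner_apply, dotProduct, mulVec, mul_comm]
  have h3 : ‖Y‖ * ‖Y‖ = y ⬝ᵥ y := by
    rw [← pow_two, EuclideanSpace.norm_sq_eq]
    simp [hY, dotProduct, pow_two]
  rw [h2, h3] at h1
  exact (le_abs_self _).trans (by simpa using h1)

open Matrix in
/-- A vector attaining the maximum of the Rayleigh quotient is an eigenvector. -/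
theorem Matrix.IsSymm.mulVec_eq_of_rayleigh_max {V : Type*} [Fintype V] [DecidableEq V]
    {A : Matrix V V ℝ} (hA : A.IsSymm) {r : ℝ} (hr : ∀ y : V → ℝ, y ⬝ᵥ A *ᵥ y ≤ r * (y ⬝ᵥ y))
    {x : V → ℝ} (hx : r * (x ⬝ᵥ x) ≤ x ⬝ᵥ A *ᵥ x) : A *ᵥ x = r • x := by
  funext v
  -- First variation at the maximiser along a coordinate vector: the linear coefficient must vanish.
  have key : ∀ t : ℝ, 2 * t * ((A *ᵥ x) v - r * x v) + t ^ 2 * (A v v - r) ≤ 0 := by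
    intro t
    have h := hr (x + t • Pi.single v 1)
    have h1 : x ⬝ᵥ A *ᵥ Pi.single v 1 = (A *ᵥ x) v := by
      rw [dotProduct_mulVec, ← mulVec_transpose, hA.eq]
      simp
    simp only [mulVec_add, mulVec_smul, add_dotProduct, dotProduct_add, smul_dotProduct,
      dotProduct_smul, h1, single_one_dotProduct, dotProduct_single_one, smul_eq_mul] at h
    simp at h
    nlinarith
  have hc : (A *ᵥ x) v - r * x v = 0 := by
    set c := (A *ᵥ x) v - r * x v
    set d := A v v - r
    by_contra hne
    have hpos : 0 < c ^ 2 := by positivity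
    -- This `t` has the sign of `c` and is small enough for the linear term to beat the quadratic
    -- one.
    have := key (c / (1 + |d|))
    have hd : 0 < 1 + |d| := by positivity
    have h2 : 2 * (c / (1 + |d|)) * c + (c / (1 + |d|)) ^ 2 * d =
        c ^ 2 * (2 * (1 + |d|) + d) / (1 + |d|) ^ 2 := by
      field_simp
    rw [h2] at this
    have h3 : 0 < c ^ 2 * (2 * (1 + |d|) + d) / (1 + |d|) ^ 2 := by
      have := neg_abs_le d
      have := abs_nonneg d
      have : 0 < 2 * (1 + |d|) + d := by linarith
      positivity
    linarith
  simpa [sub_eq_zero] using hc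

open Matrix in
/-- The spectral radius of a nonnegative symmetric matrix has a nonnegative eigenvector. -/
theorem Matrix.IsSymm.exists_nonneg_eigenvector {V : Type*} [Fintype V] [DecidableEq V]
    [Nonempty V] {A : Matrix V V ℝ} (hA : A.IsSymm) (h0 : ∀ i j, 0 ≤ A i j) :
    ∃ x : V → ℝ, 0 ≤ x ∧ x ≠ 0 ∧
      A *ᵥ x = (spectralRadius ℂ (A.map (fun x : ℝ => (x : ℂ)))).toReal • x := by
  set B : Matrix V V ℂ := A.map (fun x : ℝ => (x : ℂ)) with hB
  have : ∃ μ ∈ spectrum ℂ B, (‖μ‖₊ : ENNReal) = spectralRadius ℂ B := by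
    open scoped Matrix.Norms.L2Operator in
    exact spectrum.exists_nnnorm_eq_spectralRadius B
  obtain ⟨μ, hμ, hμr⟩ := this
  have hμr' : (spectralRadius ℂ B).toReal = ‖μ‖ := by rw [← hμr]; simp
  rw [← Matrix.spectrum_toLin', ← Module.End.hasEigenvalue_iff_mem_spectrum] at hμ
  obtain ⟨v, hv⟩ := hμ.exists_hasEigenvector
  have hv0 := hv.2
  have hv1 : B *ᵥ v = μ • v := by simpa using hv.apply_eq_smul
  refine ⟨fun i => ‖v i‖, fun i => norm_nonneg _, ?_, ?_⟩
  · intro h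
    apply hv0
    funext i
    simpa using congrFun h i
  -- The triangle inequality gives |μ||v| ≤ A|v| entrywise, so |v| attains the maximal Rayleigh
  -- quotient. This also shows that ρ itself, not merely some μ of modulus ρ, is an eigenvalue.
  · refine hA.mulVec_eq_of_rayleigh_max (hA.dotProduct_mulVec_le_spectralRadius) ?_
    rw [hμr', dotProduct, dotProduct, Finset.mul_sum]
    refine Finset.sum_le_sum fun i _ => ?_
    have h1 : ‖μ‖ * ‖v i‖ ≤ (A *ᵥ fun i => ‖v i‖) i := by
      have := congrFun hv1 i
      rw [← norm_mul, ← smul_eq_mul, ← Pi.smul_apply, ← this]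
      simp only [mulVec, dotProduct]
      refine (norm_sum_le _ _).trans (Finset.sum_le_sum fun j _ => ?_)
      simp [hB, abs_of_nonneg (h0 i j)]
    nlinarith [norm_nonneg (v i)]

/-! ### The Perron vector of a hypergraph and comparison edge by edge. -/

namespace FinHypergraph

theorem adjMatrix_isSymm {V : Type*} [DecidableEq V] (G : FinHypergraph V) :
    G.adjMatrix.IsSymm := by
  ext u v
  simp only [adjMatrix, Matrix.transpose_apply, Matrix.of_apply, eq_comm (a := u), and_comm]

theorem adjMatrix_nonneg {V : Type*} [DecidableEq V] (G : FinHypergraph V) (u v : V) :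
    0 ≤ G.adjMatrix u v := by
  simp only [adjMatrix, Matrix.of_apply]
  split_ifs
  · rfl
  · refine Finset.sum_nonneg fun e he => ?_
    have : (2 : ℝ) ≤ e.card := by exact_mod_cast G.two_le_card e (Finset.mem_filter.1 he).1
    exact one_div_nonneg.2 (by linarith)

theorem adjMatrix_pos {V : Type*} [DecidableEq V] (G : FinHypergraph V) {u v : V}
    (huv : u ≠ v) (h : G.Adj u v) : 0 < G.adjMatrix u v := by
  obtain ⟨e, he, hu, hv⟩ := h
  simp only [adjMatrix, Matrix.of_apply, if_neg huv]
  have h2 : ∀ e ∈ G.edges, 0 < 1 / ((e.card : ℝ) - 1) := fun e he => by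
    have : (2 : ℝ) ≤ e.card := by exact_mod_cast G.two_le_card e he
    exact one_div_pos.2 (by linarith)
  exact Finset.sum_pos (fun e he => h2 e (Finset.mem_filter.1 he).1)
    ⟨e, Finset.mem_filter.2 ⟨he, hu, hv⟩⟩

open Matrix in
/-- The Perron vector of a connected hypergraph. -/
theorem IsConnected.exists_pos_eigenvector {V : Type*} [Fintype V] [DecidableEq V]
    {G : FinHypergraph V} (hG : G.IsConnected) :
    ∃ x : V → ℝ, (∀ v, 0 < x v) ∧ G.adjMatrix *ᵥ x = G.rho • x := by
  have := hG.1
  obtain ⟨x, hx0, hxne, hx⟩ := G.adjMatrix_isSymm.exists_nonneg_eigenvector G.adjMatrix_nonneg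
  refine ⟨x, ?_, hx⟩
  -- A zero entry spreads to all neighbours, since the row at `u` is a vanishing sum of nonnegative
  -- terms.
  have step : ∀ u v, G.Adj u v → x u = 0 → x v = 0 := by
    intro u v huv hu
    by_cases h : u = v
    · rwa [← h]
    have h1 := congrFun hx u
    simp only [Pi.smul_apply, hu, smul_zero, mulVec, dotProduct] at h1
    rw [Finset.sum_eq_zero_iff_of_nonneg
      (fun i _ => mul_nonneg (G.adjMatrix_nonneg u i) (hx0 i))] at h1
    exact (mul_eq_zero.1 (h1 v (Finset.mem_univ v))).resolve_left (G.adjMatrix_pos h huv).ne'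
  by_contra! hcon
  obtain ⟨v, hv⟩ := hcon
  have hv0 : x v = 0 := le_antisymm hv (hx0 v)
  apply hxne
  funext u
  induction hG.2 v u with
  | refl => exact hv0
  | tail _ hbc ih => exact step _ _ hbc ih

/-- The value at `v` of the (unnormalized) adjacency operator of the single edge `e`. -/
def edgeRow {V : Type*} [DecidableEq V] (x : V → ℝ) (e : Finset V) (v : V) : ℝ :=
  if v ∈ e then ∑ u ∈ e.erase v, x u else 0

/-- The (unnormalized) quadratic form of the single edge `e`. -/
def edgeForm {V : Type*} (x : V → ℝ) (e : Finset V) : ℝ :=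
  (∑ v ∈ e, x v) ^ 2 - ∑ v ∈ e, x v ^ 2

theorem sum_mul_edgeRow {V : Type*} [Fintype V] [DecidableEq V] (x : V → ℝ) (e : Finset V) :
    ∑ v, x v * edgeRow x e v = edgeForm x e := by
  have h : ∀ v, x v * edgeRow x e v = if v ∈ e then x v * (∑ u ∈ e, x u) - x v ^ 2 else 0 := by
    intro v
    unfold edgeRow
    split_ifs with hv
    · rw [← Finset.add_sum_erase e x hv]; ring
    · simp
  simp only [h, Finset.sum_ite_mem, Finset.univ_inter, Finset.sum_sub_distrib, ← Finset.sum_mul,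
    edgeForm]
  ring

-- Uniformity turns all weights into the single factor 1/(k-1), so that hypergraphs can be compared
-- through unweighted sums over edges.
open Matrix in
theorem IsUniform.adjMatrix_mulVec {V : Type*} [Fintype V] [DecidableEq V]
    {G : FinHypergraph V} {k : ℕ} (hG : G.IsUniform k) (x : V → ℝ) (v : V) :
    (G.adjMatrix *ᵥ x) v = 1 / ((k : ℝ) - 1) * ∑ e ∈ G.edges, edgeRow x e v := by
  simp only [mulVec, dotProduct, adjMatrix, of_apply]
  have h1 : ∀ u, (if v = u then 0 else ∑ e ∈ G.edges with v ∈ e ∧ u ∈ e,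
      1 / ((e.card : ℝ) - 1)) * x u =
      ∑ e ∈ G.edges, 1 / ((k : ℝ) - 1) * (if v ∈ e then if u ∈ e.erase v then x u else 0 else 0) := by
    intro u
    by_cases h : v = u
    · subst h; simp
    · rw [if_neg h, Finset.sum_mul, Finset.sum_filter]
      refine Finset.sum_congr rfl fun e he => ?_
      rw [hG e he]
      by_cases hv : v ∈ e <;> by_cases hu : u ∈ e <;> simp [hv, hu, Ne.symm h]
  simp only [h1]
  rw [Finset.sum_comm, Finset.mul_sum]
  refine Finset.sum_congr rfl fun e _ => ?_
  rw [← Finset.mul_sum]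
  congr 1
  unfold edgeRow
  split_ifs
  · rw [Finset.sum_ite_mem, Finset.univ_inter]
  · simp

open Matrix in
theorem IsUniform.dotProduct_adjMatrix_mulVec {V : Type*} [Fintype V] [DecidableEq V]
    {G : FinHypergraph V} {k : ℕ} (hG : G.IsUniform k) (x : V → ℝ) :
    x ⬝ᵥ G.adjMatrix *ᵥ x = 1 / ((k : ℝ) - 1) * ∑ e ∈ G.edges, edgeForm x e := by
  simp only [dotProduct, hG.adjMatrix_mulVec, ← sum_mul_edgeRow]
  rw [Finset.sum_comm, Finset.mul_sum]
  refine Finset.sum_congr rfl fun v _ => ?_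
  rw [← Finset.mul_sum]
  ring

open Matrix in
/-- Comparison of spectral radii through the Perron vector of the smaller hypergraph. -/
theorem rho_lt_rho_of_edgeForm_le {V : Type*} [Fintype V] [DecidableEq V]
    {G H : FinHypergraph V} {k : ℕ} (hk : 2 ≤ k) (hGu : G.IsUniform k) (hHu : H.IsUniform k)
    {x : V → ℝ} (hpos : ∀ v, 0 < x v) (hx : G.adjMatrix *ᵥ x = G.rho • x)
    (hform : ∑ e ∈ G.edges, edgeForm x e ≤ ∑ e ∈ H.edges, edgeForm x e)
    {y : V} (hy : ∑ e ∈ G.edges, edgeRow x e y < ∑ e ∈ H.edges, edgeRow x e y) :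
    G.rho < H.rho := by
  have hk' : 0 < 1 / ((k : ℝ) - 1) := by
    have : (2 : ℝ) ≤ k := by exact_mod_cast hk
    exact one_div_pos.2 (by linarith)
  have hxx : 0 < x ⬝ᵥ x :=
    Finset.sum_pos (fun v _ => mul_pos (hpos v) (hpos v)) ⟨y, Finset.mem_univ y⟩
  -- Otherwise `x` maximises the Rayleigh quotient of `H` with value `G.rho`, hence is an
  -- eigenvector of both matrices for the same value, and the rows at `y` would agree.
  by_contra! hle
  have h1 : G.rho * (x ⬝ᵥ x) ≤ x ⬝ᵥ H.adjMatrix *ᵥ x := by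
    have : G.rho * (x ⬝ᵥ x) = x ⬝ᵥ G.adjMatrix *ᵥ x := by simp [hx]
    rw [this, hGu.dotProduct_adjMatrix_mulVec, hHu.dotProduct_adjMatrix_mulVec]
    exact mul_le_mul_of_nonneg_left hform hk'.le
  have h2 : ∀ z : V → ℝ, z ⬝ᵥ H.adjMatrix *ᵥ z ≤ G.rho * (z ⬝ᵥ z) := fun z =>
    (H.adjMatrix_isSymm.dotProduct_mulVec_le_spectralRadius z).trans
      (mul_le_mul_of_nonneg_right hle (Finset.sum_nonneg fun v _ => mul_self_nonneg _))
  have h3 := H.adjMatrix_isSymm.mulVec_eq_of_rayleigh_max h2 h1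
  have h4 := congrFun (h3.trans hx.symm) y
  rw [hGu.adjMatrix_mulVec, hHu.adjMatrix_mulVec] at h4
  exact hy.ne' (mul_left_cancel₀ hk'.ne' h4)

/-! ### Isomorphism invariance. -/

theorem Isomorphic.symm {V W : Type*} {G : FinHypergraph V} {H : FinHypergraph W}
    (h : G.Isomorphic H) : H.Isomorphic G := by
  obtain ⟨f, hf⟩ := h
  refine ⟨f.symm, fun e => ?_⟩
  rw [hf]
  simp [Finset.map_map]

theorem Isomorphic.edges_eq {V W : Type*} {G : FinHypergraph V} {H : FinHypergraph W}
    {f : V ≃ W} (h : ∀ e : Finset V, e ∈ G.edges ↔ e.map f.toEmbedding ∈ H.edges) :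
    H.edges = G.edges.map (Finset.mapEmbedding f.toEmbedding).toEmbedding := by
  ext e
  simp only [Finset.mem_map, RelEmbedding.coe_toEmbedding, Finset.mapEmbedding_apply]
  constructor
  · intro he
    refine ⟨e.map f.symm.toEmbedding, ?_, ?_⟩
    · rw [h]
      simpa [Finset.map_map, ← Equiv.trans_toEmbedding] using he
    · simp [Finset.map_map]
  · rintro ⟨d, hd, rfl⟩
    exact (h d).1 hd

theorem Isomorphic.card_edges_eq {V W : Type*} {G : FinHypergraph V} {H : FinHypergraph W}
    (h : G.Isomorphic H) : G.edges.card = H.edges.card := by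
  obtain ⟨f, hf⟩ := h
  rw [Isomorphic.edges_eq hf, Finset.card_map]

theorem Isomorphic.rho_eq {V W : Type*} [Fintype V] [DecidableEq V] [Fintype W] [DecidableEq W]
    {G : FinHypergraph V} {H : FinHypergraph W} (h : G.Isomorphic H) : G.rho = H.rho := by
  obtain ⟨f, hf⟩ := h
  have h1 : H.adjMatrix.map (fun x : ℝ => (x : ℂ)) =
      Matrix.reindexAlgEquiv ℂ ℂ f (G.adjMatrix.map (fun x : ℝ => (x : ℂ))) := by
    ext u v
    simp only [Matrix.map_apply, Matrix.coe_reindexAlgEquiv, Matrix.reindex_apply,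
      Matrix.submatrix_apply, adjMatrix, Matrix.of_apply, Isomorphic.edges_eq hf,
      Finset.filter_map, Finset.sum_map, EmbeddingLike.apply_eq_iff_eq]
    simp
  unfold rho spectralRadius
  rw [h1, AlgEquiv.spectrum_eq]

/-! ### Recognising 2-hypercycles with pendant edges. -/

/-- The edges of the cycle in a hypercycle of length two with attached pendant edges. -/
def cycleEdge (k : ℕ) (J : Type*) [DecidableEq J] (i : Fin 2) :
    Finset ((Fin 2 ⊕ Fin 2 × Fin (k - 2)) ⊕ J × Fin (k - 1)) :=
  {Sum.inl (Sum.inl 0), Sum.inl (Sum.inl 1)} ∪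
    Finset.univ.image fun l : Fin (k - 2) => Sum.inl (Sum.inr (i, l))

/-- The pendant edges of a hypercycle of length two with attached pendant edges. -/
def pendantEdge (k : ℕ) {J : Type*} [DecidableEq J] (a : J → Fin 2 ⊕ Fin 2 × Fin (k - 2))
    (j : J) : Finset ((Fin 2 ⊕ Fin 2 × Fin (k - 2)) ⊕ J × Fin (k - 1)) :=
  insert (Sum.inl (a j)) (Finset.univ.image fun l : Fin (k - 1) => Sum.inr (j, l))

section

variable {k : ℕ} {J : Type*} [DecidableEq J]
  {a : J → Fin 2 ⊕ Fin 2 × Fin (k - 2)}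

theorem card_cycleEdge (hk : 3 ≤ k) (i : Fin 2) : (cycleEdge k J i).card = k := by
  unfold cycleEdge
  rw [Finset.card_union_of_disjoint, Finset.card_pair (by simp),
    Finset.card_image_of_injective]
  · simp; omega
  · intro x y h; simpa using h
  · rw [Finset.disjoint_left]; simp

theorem card_pendantEdge (hk : 3 ≤ k) (j : J) : (pendantEdge k a j).card = k := by
  unfold pendantEdge
  rw [Finset.card_insert_of_notMem (by simp), Finset.card_image_of_injective]
  · simp; omega
  · intro x y h; simpa using h

variable [Fintype J]

theorem attach_twoCycle_edges (hk : 3 ≤ k) :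
    (attach k hk (twoCycle k) a).edges =
      Finset.univ.image (cycleEdge k J) ∪ Finset.univ.image (pendantEdge k a) := by
  unfold attach twoCycle
  simp only [Finset.image_image]
  congr 2
  funext i
  simp only [Function.comp_apply, cycleEdge, Finset.image_union, Finset.image_insert,
    Finset.image_singleton, Finset.image_image]
  rfl

theorem mem_attach_twoCycle_edges (hk : 3 ≤ k)
    {e : Finset ((Fin 2 ⊕ Fin 2 × Fin (k - 2)) ⊕ J × Fin (k - 1))} :
    e ∈ (attach k hk (twoCycle k) a).edges ↔
      (∃ i, e = cycleEdge k J i) ∨ ∃ j, e = pendantEdge k a j := by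
  rw [attach_twoCycle_edges]
  simp [eq_comm]

theorem isUniform_attach_twoCycle (hk : 3 ≤ k) : (attach k hk (twoCycle k) a).IsUniform k := by
  intro e he
  rcases (mem_attach_twoCycle_edges hk).1 he with ⟨i, rfl⟩ | ⟨j, rfl⟩
  · exact card_cycleEdge hk i
  · exact card_pendantEdge hk j

theorem card_edges_attach_twoCycle (hk : 3 ≤ k) :
    (attach k hk (twoCycle k) a).edges.card = 2 + Fintype.card J := by
  rw [attach_twoCycle_edges, Finset.card_union_of_disjoint, Finset.card_image_of_injective,
    Finset.card_image_of_injective, Finset.card_univ, Finset.card_univ, Fintype.card_fin]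
  · intro i j h
    have h1 : Sum.inr (i, (⟨0, by omega⟩ : Fin (k - 1))) ∈ pendantEdge k a j := by
      rw [← h]; simp [pendantEdge]
    simpa [pendantEdge, eq_comm] using h1
  · intro i j h
    have h1 : Sum.inl (Sum.inr (i, (⟨0, by omega⟩ : Fin (k - 2)))) ∈ cycleEdge k J j := by
      rw [← h]; simp [cycleEdge]
    simpa [cycleEdge, eq_comm] using h1
  · rw [Finset.disjoint_left]
    intro e he he'
    obtain ⟨i, -, rfl⟩ := Finset.mem_image.1 he
    obtain ⟨j, -, h⟩ := Finset.mem_image.1 he'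
    have h1 : Sum.inr (j, (⟨0, by omega⟩ : Fin (k - 1))) ∈ cycleEdge k J i := by
      rw [← h]; simp [pendantEdge]
    simp [cycleEdge] at h1

theorem Adj.symm {V : Type*} {G : FinHypergraph V} {u v : V} (h : G.Adj u v) : G.Adj v u := by
  obtain ⟨e, he, hu, hv⟩ := h
  exact ⟨e, he, hv, hu⟩

theorem isConnected_attach_twoCycle (hk : 3 ≤ k) {b : J → Fin 2}
    (ha : ∀ j, a j = Sum.inl (b j)) : (attach k hk (twoCycle k) a).IsConnected := by
  set H := attach k hk (twoCycle k) a
  have hC : ∀ i, cycleEdge k J i ∈ H.edges := fun i =>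
    (mem_attach_twoCycle_edges hk).2 (Or.inl ⟨i, rfl⟩)
  have hP : ∀ j, pendantEdge k a j ∈ H.edges := fun j =>
    (mem_attach_twoCycle_edges hk).2 (Or.inr ⟨j, rfl⟩)
  have h0 : ∀ i : Fin 2, H.Adj (Sum.inl (Sum.inl 0)) (Sum.inl (Sum.inl i)) := by
    intro i
    refine ⟨_, hC 0, by simp [cycleEdge], ?_⟩
    fin_cases i <;> simp [cycleEdge]
  have hmain : ∀ y, Relation.ReflTransGen H.Adj (Sum.inl (Sum.inl 0)) y := by
    rintro ((i | ⟨i, l⟩) | ⟨j, l⟩)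
    · exact .single (h0 i)
    · exact .single ⟨_, hC i, by simp [cycleEdge], by simp [cycleEdge]⟩
    · refine (Relation.ReflTransGen.single (h0 (b j))).tail ⟨_, hP j, ?_, ?_⟩ <;>
        simp [pendantEdge, ha]
  have hsymm : Std.Symm H.Adj := ⟨fun _ _ => Adj.symm⟩
  exact ⟨⟨Sum.inl (Sum.inl 0)⟩, fun u v =>
    (Std.Symm.symm _ _ (hmain u)).trans (hmain v)⟩

theorem isUnicyclic_attach_twoCycle (hk : 3 ≤ k) {b : J → Fin 2}
    (ha : ∀ j, a j = Sum.inl (b j)) : (attach k hk (twoCycle k) a).IsUnicyclic k := by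
  refine ⟨isConnected_attach_twoCycle hk ha, isUniform_attach_twoCycle hk, ?_⟩
  rw [card_edges_attach_twoCycle]
  simp only [Fintype.card_sum, Fintype.card_prod, Fintype.card_fin]
  obtain ⟨l, rfl⟩ : ∃ l, k = l + 3 := ⟨k - 3, by omega⟩
  rw [show l + 3 - 2 = l + 1 by omega, show l + 3 - 1 = l + 2 by omega]
  push_cast
  ring

/-- A description of the hypercycle of length two with pendant edges attached at the two
vertices of degree two. -/
theorem isomorphic_attach_twoCycle (hk : 3 ≤ k) {V : Type*} [Fintype V] [DecidableEq V]
    {G : FinHypergraph V} {c : Fin 2 → V} (hc : c.Injective) {C : Fin 2 → Finset V}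
    {P : J → Finset V} {b : J → Fin 2} (ha : ∀ j, a j = Sum.inl (b j))
    (hC : ∀ i j, c j ∈ C i) (hP : ∀ j, c (b j) ∈ P j)
    (hCk : ∀ i, (C i).card = k) (hPk : ∀ j, (P j).card = k)
    (hcov : ∀ y, (∃ i, y ∈ C i) ∨ ∃ j, y ∈ P j)
    (hcard : Fintype.card V = 2 + 2 * (k - 2) + Fintype.card J * (k - 1))
    (hE : ∀ e, e ∈ G.edges ↔ (∃ i, e = C i) ∨ ∃ j, e = P j) :
    G.Isomorphic (attach k hk (twoCycle k) a) := by
  have hT : ∀ i, ((C i) \ (Finset.univ.image c)).card = k - 2 := fun i => by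
    rw [Finset.card_sdiff_of_subset, hCk, Finset.card_image_of_injective _ hc]
    · simp
    · intro y hy
      obtain ⟨j, -, rfl⟩ := Finset.mem_image.1 hy
      exact hC i j
  have hS : ∀ j, ((P j).erase (c (b j))).card = k - 1 := fun j => by
    rw [Finset.card_erase_of_mem (hP j), hPk]
  let t : ∀ i, Fin (k - 2) ≃ ((C i) \ (Finset.univ.image c) : Finset V) := fun i =>
    (Finset.equivFinOfCardEq (hT i)).symm
  let s : ∀ j, Fin (k - 1) ≃ ((P j).erase (c (b j)) : Finset V) := fun j =>
    (Finset.equivFinOfCardEq (hS j)).symm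
  let φ : (Fin 2 ⊕ Fin 2 × Fin (k - 2)) ⊕ J × Fin (k - 1) → V :=
    Sum.elim (Sum.elim c fun q => t q.1 q.2) fun q => s q.1 q.2
  have hφC : ∀ i, (cycleEdge k J i).image φ = C i := by
    intro i
    ext y
    simp only [cycleEdge, Finset.image_union, Finset.image_insert, Finset.image_singleton,
      Finset.image_image, Finset.mem_union, Finset.mem_insert, Finset.mem_singleton,
      Finset.mem_image, Finset.mem_univ, true_and, Function.comp_apply]
    constructor
    · rintro ((rfl | rfl) | ⟨l, rfl⟩)
      · exact hC i 0
      · exact hC i 1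
      · exact (Finset.mem_sdiff.1 (t i l).2).1
    · intro hy
      by_cases h : y ∈ Finset.univ.image c
      · obtain ⟨j, -, rfl⟩ := Finset.mem_image.1 h
        left
        fin_cases j
        · exact Or.inl rfl
        · exact Or.inr rfl
      · right
        refine ⟨(t i).symm ⟨y, Finset.mem_sdiff.2 ⟨hy, h⟩⟩, ?_⟩
        simp [φ]
  have hφP : ∀ j, (pendantEdge k a j).image φ = P j := by
    intro j
    ext y
    simp only [pendantEdge, Finset.image_insert, Finset.image_image, Finset.mem_insert,
      Finset.mem_image, Finset.mem_univ, true_and, Function.comp_apply]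
    constructor
    · rintro (rfl | ⟨l, rfl⟩)
      · rw [ha]
        exact hP j
      · exact (Finset.mem_erase.1 (s j l).2).2
    · intro hy
      by_cases h : y = c (b j)
      · left
        rw [h, ha]
        rfl
      · right
        refine ⟨(s j).symm ⟨y, Finset.mem_erase.2 ⟨h, hy⟩⟩, ?_⟩
        simp [φ]
  have hsurj : Function.Surjective φ := by
    intro y
    rcases hcov y with ⟨i, hi⟩ | ⟨j, hj⟩
    · rw [← hφC] at hi
      obtain ⟨q, -, hq⟩ := Finset.mem_image.1 hi
      exact ⟨q, hq⟩
    · rw [← hφP] at hj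
      obtain ⟨q, -, hq⟩ := Finset.mem_image.1 hj
      exact ⟨q, hq⟩
  -- Counting replaces any check of intersections: the edges cover `V`, and `V` has just as many
  -- vertices as the model, so no two edges overlap more than in the model.
  have hbij : Function.Bijective φ := by
    rw [Fintype.bijective_iff_surjective_and_card]
    refine ⟨hsurj, ?_⟩
    simp [hcard]
  refine Isomorphic.symm ⟨Equiv.ofBijective φ hbij, fun e => ?_⟩
  rw [Finset.map_eq_image, show e.image (Equiv.ofBijective φ hbij).toEmbedding = e.image φ from rfl,
    hE, mem_attach_twoCycle_edges]
  refine or_congr (exists_congr fun i => ?_) (exists_congr fun j => ?_)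
  · rw [← hφC, (Finset.image_injective hbij.1).eq_iff]
  · rw [← hφP, (Finset.image_injective hbij.1).eq_iff]

end

/-- A `k`-uniform hypergraph with `m` edges and `(k - 1) m` vertices in which one vertex lies in
all edges is `U*`. -/
theorem isomorphic_uStar {k n : ℕ} (hk : 3 ≤ k) {V : Type*} [Fintype V] [DecidableEq V]
    {G : FinHypergraph V} (hG : G.IsUniform k) (hn : Fintype.card V = n) {m : ℕ}
    (hm : n = (k - 1) * m) {ι : Type*} [DecidableEq ι] {I : Finset ι} (hI : I.card = m)
    {Φ : ι → Finset V} (hΦ : G.edges = I.image Φ) {w v : V} (hwv : w ≠ v) {c₁ c₂ : ι}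
    (h₁ : c₁ ∈ I) (h₂ : c₂ ∈ I) (h₁₂ : c₁ ≠ c₂) (hv₁ : v ∈ Φ c₁) (hv₂ : v ∈ Φ c₂)
    (hw : ∀ e ∈ I, w ∈ Φ e) (hcov : ∀ y, ∃ e ∈ I, y ∈ Φ e) :
    G.Isomorphic (uStar k n hk) := by
  have hm' : n / (k - 1) = m := by
    rw [hm, Nat.mul_div_cancel_left _ (by omega)]
  have hsub : ({c₁, c₂} : Finset ι) ⊆ I := by
    intro e he
    simp only [Finset.mem_insert, Finset.mem_singleton] at he
    rcases he with rfl | rfl <;> assumption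
  have hR : (I \ {c₁, c₂}).card = n / (k - 1) - 2 := by
    rw [Finset.card_sdiff_of_subset hsub, Finset.card_pair h₁₂, hm', hI]
  have hm2 : 2 ≤ m := by
    rw [← hI, ← Finset.card_pair h₁₂]; exact Finset.card_le_card hsub
  let r := (Finset.equivFinOfCardEq hR).symm
  have hrmem : ∀ j, (r j : ι) ∈ I := fun j => (Finset.mem_sdiff.1 (r j).2).1
  have hE : ∀ e, e ∈ G.edges ↔ (∃ i, e = ![Φ c₁, Φ c₂] i) ∨ ∃ j, e = Φ (r j) := by
    intro e
    rw [hΦ]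
    constructor
    · intro he
      obtain ⟨i, hi, rfl⟩ := Finset.mem_image.1 he
      by_cases h : i ∈ ({c₁, c₂} : Finset ι)
      · simp only [Finset.mem_insert, Finset.mem_singleton] at h
        rcases h with rfl | rfl
        · exact Or.inl ⟨0, rfl⟩
        · exact Or.inl ⟨1, rfl⟩
      · exact Or.inr ⟨r.symm ⟨i, Finset.mem_sdiff.2 ⟨hi, h⟩⟩, by simp⟩
    · rintro (⟨i, rfl⟩ | ⟨j, rfl⟩)
      · fin_cases i
        · exact Finset.mem_image_of_mem _ h₁
        · exact Finset.mem_image_of_mem _ h₂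
      · exact Finset.mem_image_of_mem _ (hrmem j)
  refine isomorphic_attach_twoCycle hk (c := ![w, v]) (C := ![Φ c₁, Φ c₂])
    (P := fun j => Φ (r j)) (b := fun _ => 0) ?_ (fun _ => rfl) ?_ ?_ ?_ ?_ ?_ ?_ hE
  · intro i j h
    fin_cases i <;> fin_cases j <;> simp_all
  · intro i j
    fin_cases i <;> fin_cases j <;> simp [hw _ h₁, hw _ h₂, hv₁, hv₂]
  · exact fun j => hw _ (hrmem j)
  · exact fun i => hG _ ((hE _).2 (Or.inl ⟨i, rfl⟩))
  · exact fun j => hG _ ((hE _).2 (Or.inr ⟨j, rfl⟩))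
  · intro y
    obtain ⟨i, hi, hy⟩ := hcov y
    have he : Φ i ∈ G.edges := by rw [hΦ]; exact Finset.mem_image_of_mem _ hi
    rcases (hE _).1 he with ⟨i', h⟩ | ⟨j, h⟩
    · exact Or.inl ⟨i', h ▸ hy⟩
    · exact Or.inr ⟨j, h ▸ hy⟩
  · rw [hn, Fintype.card_fin, hm', hm]
    obtain ⟨l, rfl⟩ : ∃ l, k = l + 3 := ⟨k - 3, by omega⟩
    obtain ⟨q, rfl⟩ : ∃ q, m = q + 2 := ⟨_, (Nat.sub_add_cancel hm2).symm⟩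
    rw [show l + 3 - 2 = l + 1 by omega, show l + 3 - 1 = l + 2 by omega,
      show q + 2 - 2 = q by omega]
    ring

/-- A `k`-uniform hypergraph with `m` edges and `(k - 1) m` vertices in which one vertex lies in
all edges except for one, which meets two others in a common vertex, is `F`. -/
theorem isomorphic_hyperF {k n : ℕ} (hk : 3 ≤ k) {V : Type*} [Fintype V] [DecidableEq V]
    {G : FinHypergraph V} (hG : G.IsUniform k) (hn : Fintype.card V = n) {m : ℕ}
    (hm : n = (k - 1) * m) {ι : Type*} [DecidableEq ι] {I : Finset ι} (hI : I.card = m)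
    {Φ : ι → Finset V} (hΦ : G.edges = I.image Φ) {w v : V} (hwv : w ≠ v) {c₁ c₂ f : ι}
    (h₁ : c₁ ∈ I) (h₂ : c₂ ∈ I) (hf : f ∈ I) (h₁₂ : c₁ ≠ c₂) (h₁f : c₁ ≠ f) (h₂f : c₂ ≠ f)
    (hv₁ : v ∈ Φ c₁) (hv₂ : v ∈ Φ c₂) (hvf : v ∈ Φ f)
    (hw : ∀ e ∈ I, e ≠ f → w ∈ Φ e) (hcov : ∀ y, ∃ e ∈ I, y ∈ Φ e) :
    G.Isomorphic (hyperF k n hk) := by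
  have hm' : n / (k - 1) = m := by
    rw [hm, Nat.mul_div_cancel_left _ (by omega)]
  have hsub : ({c₁, c₂, f} : Finset ι) ⊆ I := by
    intro e he
    simp only [Finset.mem_insert, Finset.mem_singleton] at he
    rcases he with rfl | rfl | rfl <;> assumption
  have h3 : ({c₁, c₂, f} : Finset ι).card = 3 := Finset.card_eq_three.2 ⟨_, _, _, h₁₂, h₁f, h₂f, rfl⟩
  have hR : (I \ {c₁, c₂, f}).card = n / (k - 1) - 3 := by
    rw [Finset.card_sdiff_of_subset hsub, h3, hm', hI]
  have hm3 : 3 ≤ m := by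
    rw [← hI, ← h3]; exact Finset.card_le_card hsub
  let r := (Finset.equivFinOfCardEq hR).symm
  have hrmem : ∀ j, (r j : ι) ∈ I := fun j => (Finset.mem_sdiff.1 (r j).2).1
  have hrf : ∀ j, (r j : ι) ≠ f := fun j h => (Finset.mem_sdiff.1 (r j).2).2 (by simp [h])
  let P : Fin (n / (k - 1) - 3) ⊕ Fin 1 → Finset V := Sum.elim (fun j => Φ (r j)) fun _ => Φ f
  have hE : ∀ e, e ∈ G.edges ↔ (∃ i, e = ![Φ c₁, Φ c₂] i) ∨ ∃ j, e = P j := by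
    intro e
    rw [hΦ]
    constructor
    · intro he
      obtain ⟨i, hi, rfl⟩ := Finset.mem_image.1 he
      by_cases h : i ∈ ({c₁, c₂, f} : Finset ι)
      · simp only [Finset.mem_insert, Finset.mem_singleton] at h
        rcases h with rfl | rfl | rfl
        · exact Or.inl ⟨0, rfl⟩
        · exact Or.inl ⟨1, rfl⟩
        · exact Or.inr ⟨Sum.inr 0, rfl⟩
      · exact Or.inr ⟨Sum.inl (r.symm ⟨i, Finset.mem_sdiff.2 ⟨hi, h⟩⟩), by simp [P]⟩
    · rintro (⟨i, rfl⟩ | ⟨j | j, rfl⟩)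
      · fin_cases i
        · exact Finset.mem_image_of_mem _ h₁
        · exact Finset.mem_image_of_mem _ h₂
      · exact Finset.mem_image_of_mem _ (hrmem j)
      · exact Finset.mem_image_of_mem _ hf
  refine isomorphic_attach_twoCycle hk (c := ![w, v]) (C := ![Φ c₁, Φ c₂]) (P := P)
    (b := Sum.elim (fun _ => 0) fun _ => 1) ?_ ?_ ?_ ?_ ?_ ?_ ?_ ?_ hE
  · intro i j h
    fin_cases i <;> fin_cases j <;> simp_all
  · rintro (j | j) <;> rfl
  · intro i j
    fin_cases i <;> fin_cases j <;> simp [hw _ h₁ h₁f, hw _ h₂ h₂f, hv₁, hv₂]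
  · rintro (j | j)
    · exact hw _ (hrmem j) (hrf j)
    · exact hvf
  · exact fun i => hG _ ((hE _).2 (Or.inl ⟨i, rfl⟩))
  · exact fun j => hG _ ((hE _).2 (Or.inr ⟨j, rfl⟩))
  · intro y
    obtain ⟨i, hi, hy⟩ := hcov y
    have he : Φ i ∈ G.edges := by rw [hΦ]; exact Finset.mem_image_of_mem _ hi
    rcases (hE _).1 he with ⟨i', h⟩ | ⟨j, h⟩
    · exact Or.inl ⟨i', h ▸ hy⟩
    · exact Or.inr ⟨j, h ▸ hy⟩
  · rw [hn, Fintype.card_sum, Fintype.card_fin, Fintype.card_fin, hm', hm]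
    obtain ⟨l, rfl⟩ : ∃ l, k = l + 3 := ⟨k - 3, by omega⟩
    obtain ⟨q, rfl⟩ : ∃ q, m = q + 3 := ⟨_, (Nat.sub_add_cancel hm3).symm⟩
    rw [show l + 3 - 2 = l + 1 by omega, show l + 3 - 1 = l + 2 by omega,
      show q + 3 - 3 = q by omega]
    ring

/-! ### Rooting a unicyclic hypergraph. -/

/-- `v` is reached from `w` by a chain of `n` steps. -/
def ReachIn {V : Type*} (G : FinHypergraph V) (w : V) : ℕ → V → Prop
  | 0, v => v = w
  | n + 1, v => ∃ u, G.ReachIn w n u ∧ G.Adj u v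

theorem IsConnected.exists_distance {V : Type*} {G : FinHypergraph V} (hG : G.IsConnected)
    (w : V) : ∃ d : V → ℕ, d w = 0 ∧ ∀ v, v ≠ w → ∃ u, G.Adj u v ∧ d u < d v := by
  classical
  have hex : ∀ v, ∃ n, G.ReachIn w n v := by
    intro v
    induction hG.2 w v with
    | refl => exact ⟨0, rfl⟩
    | tail _ hbc ih =>
      obtain ⟨n, hn⟩ := ih
      exact ⟨n + 1, _, hn, hbc⟩
  refine ⟨fun v => Nat.find (hex v), (Nat.find_eq_zero _).2 rfl, fun v hv => ?_⟩
  have hspec := Nat.find_spec (hex v)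
  cases hd : Nat.find (hex v) with
  | zero => rw [hd] at hspec; exact absurd hspec hv
  | succ n =>
    rw [hd] at hspec
    obtain ⟨u, hu, huv⟩ := hspec
    refine ⟨u, huv, ?_⟩
    change Nat.find (hex u) < Nat.find (hex v)
    rw [hd]
    exact Nat.lt_succ_of_le (Nat.find_min' (hex u) hu)

/-- In the hypergraph `G` rooted at `w`, every edge `e` has a parent vertex `p e`; every vertex
different from `w` is a non-parent vertex of exactly one edge, except for `z`, which is a
non-parent vertex of exactly the two edges `e₁` and `e₂`. -/
structure RootedAt {V : Type*} (G : FinHypergraph V) (w : V) (p : Finset V → V) (z : V)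
    (e₁ e₂ : Finset V) : Prop where
  parent_mem : ∀ e ∈ G.edges, p e ∈ e
  parent_eq : ∀ e ∈ G.edges, w ∈ e → p e = w
  cover : ∀ y, y ≠ w → ∃ e ∈ G.edges, y ∈ e ∧ y ≠ p e
  mem₁ : e₁ ∈ G.edges
  mem₂ : e₂ ∈ G.edges
  ne : e₁ ≠ e₂
  z_mem₁ : z ∈ e₁
  z_mem₂ : z ∈ e₂
  z_ne₁ : z ≠ p e₁
  z_ne₂ : z ≠ p e₂
  eq_or_eq : ∀ e ∈ G.edges, z ∈ e → z ≠ p e → e = e₁ ∨ e = e₂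
  unique : ∀ y, y ≠ z → ∀ e ∈ G.edges, ∀ e' ∈ G.edges,
    y ∈ e → y ≠ p e → y ∈ e' → y ≠ p e' → e = e'
  -- All that is kept of the distance function: two edges cannot hang from each other. The exception
  -- is `z`, whose second covering edge need not lead closer to the root.
  acyclic : ∀ e ∈ G.edges, ∀ e' ∈ G.edges, p e ∈ e' → p e ≠ p e' → p e' ∈ e → p e = z

theorem RootedAt.z_ne_root {V : Type*} {G : FinHypergraph V} {w : V} {p : Finset V → V} {z : V}
    {e₁ e₂ : Finset V} (h : G.RootedAt w p z e₁ e₂) : z ≠ w := by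
  rintro rfl
  exact h.z_ne₁ (h.parent_eq _ h.mem₁ h.z_mem₁).symm

theorem RootedAt.symm {V : Type*} {G : FinHypergraph V} {w : V} {p : Finset V → V} {z : V}
    {e₁ e₂ : Finset V} (h : G.RootedAt w p z e₁ e₂) : G.RootedAt w p z e₂ e₁ where
  parent_mem := h.parent_mem
  parent_eq := h.parent_eq
  cover := h.cover
  mem₁ := h.mem₂
  mem₂ := h.mem₁
  ne := h.ne.symm
  z_mem₁ := h.z_mem₂
  z_mem₂ := h.z_mem₁
  z_ne₁ := h.z_ne₂
  z_ne₂ := h.z_ne₁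
  eq_or_eq := fun e he h1 h2 => (h.eq_or_eq e he h1 h2).symm
  unique := h.unique
  acyclic := h.acyclic

theorem IsUnicyclic.card_eq {V : Type*} [Fintype V] {G : FinHypergraph V} {k : ℕ} (hk : 1 ≤ k)
    (hG : G.IsUnicyclic k) : Fintype.card V = (k - 1) * G.edges.card := by
  have h := hG.2.2
  zify [hk]
  push_cast at h
  linarith

/-- Double counting of pairs (edge, non-parent vertex): every vertex other than `w` occurs at least
once, `w` never, and there are n pairs. The excess over the n-1 forced ones is 1, and it sits at a
single vertex `z`. -/
theorem IsUnicyclic.exists_rootedAt {V : Type*} [Fintype V] [DecidableEq V]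
    {G : FinHypergraph V} {k : ℕ} (hk : 1 ≤ k) (hG : G.IsUnicyclic k) (w : V) :
    ∃ p z e₁ e₂, G.RootedAt w p z e₁ e₂ := by
  obtain ⟨d, hdw, hd⟩ := hG.1.exists_distance w
  have hne : ∀ e ∈ G.edges, e.Nonempty := fun e he =>
    Finset.card_pos.1 (lt_of_lt_of_le two_pos (G.two_le_card e he))
  have hp : ∀ e, ∃ a, e ∈ G.edges → a ∈ e ∧ ∀ b ∈ e, d a ≤ d b := by
    intro e
    by_cases he : e ∈ G.edges
    · obtain ⟨a, ha, hmin⟩ := e.exists_min_image d (hne e he)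
      exact ⟨a, fun _ => ⟨ha, hmin⟩⟩
    · exact ⟨w, fun h => absurd h he⟩
  choose p hp using hp
  have hpw : ∀ e ∈ G.edges, w ∈ e → p e = w := by
    intro e he hwe
    by_contra hne
    obtain ⟨u, -, hu⟩ := hd _ hne
    have := (hp e he).2 w hwe
    omega
  have hcov : ∀ y, y ≠ w → ∃ e ∈ G.edges, y ∈ e ∧ d (p e) < d y := by
    intro y hy
    obtain ⟨u, ⟨e, he, hue, hye⟩, huy⟩ := hd y hy
    exact ⟨e, he, hye, lt_of_le_of_lt ((hp e he).2 u hue) huy⟩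
  have hpne : ∀ {e : Finset V} {y}, d (p e) < d y → y ≠ p e := by
    rintro e y h rfl
    exact lt_irrefl _ h
  let c : V → Finset (Finset V) := fun y => G.edges.filter fun e => y ∈ e.erase (p e)
  have hmemc : ∀ y e, e ∈ c y ↔ e ∈ G.edges ∧ y ∈ e ∧ y ≠ p e := by
    intro y e
    simp only [c, Finset.mem_filter, Finset.mem_erase]
    tauto
  have hcw : (c w).card = 0 := by
    rw [Finset.card_eq_zero, Finset.eq_empty_iff_forall_notMem]
    intro e he
    rw [hmemc] at he
    exact he.2.2 (hpw e he.1 he.2.1).symm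
  have hc1 : ∀ y ∈ Finset.univ.erase w, 1 ≤ (c y).card := by
    intro y hy
    obtain ⟨e, he, hye, hlt⟩ := hcov y (Finset.ne_of_mem_erase hy)
    exact Finset.card_pos.2 ⟨e, (hmemc y e).2 ⟨he, hye, hpne hlt⟩⟩
  have hsum : ∑ y, (c y).card = Fintype.card V := by
    have h1 : ∑ y, (c y).card = ∑ e ∈ G.edges, (e.erase (p e)).card := by
      simp only [c, Finset.card_filter]
      rw [Finset.sum_comm]
      simp only [Finset.sum_ite_mem, Finset.univ_inter, Finset.sum_const, smul_eq_mul, mul_one]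
    rw [h1, hG.card_eq hk, Finset.sum_congr rfl fun e he => by
      rw [Finset.card_erase_of_mem (hp e he).1, hG.2.1 e he]]
    simp [mul_comm]
  -- The truncated subtraction is exact here by `hc1`.
  have hsum' : ∑ y ∈ Finset.univ.erase w, ((c y).card - 1) = 1 := by
    have h1 : ∑ y ∈ Finset.univ.erase w, ((c y).card - 1) +
        ∑ y ∈ Finset.univ.erase w, 1 = ∑ y ∈ Finset.univ.erase w, (c y).card := by
      rw [← Finset.sum_add_distrib]
      exact Finset.sum_congr rfl fun y hy => Nat.sub_add_cancel (hc1 y hy)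
    rw [← Finset.add_sum_erase _ _ (Finset.mem_univ w), hcw] at hsum
    have h2 : 0 < Fintype.card V := Fintype.card_pos_iff.2 ⟨w⟩
    simp only [Finset.sum_const, smul_eq_mul, mul_one, Finset.card_erase_of_mem (Finset.mem_univ w),
      Finset.card_univ] at h1
    omega
  obtain ⟨z, hzw, hz⟩ : ∃ z ∈ Finset.univ.erase w, (c z).card - 1 ≠ 0 :=
    Finset.exists_ne_zero_of_sum_ne_zero (by rw [hsum']; exact one_ne_zero)
  rw [← Finset.add_sum_erase _ _ hzw] at hsum'
  have hz2 : (c z).card = 2 := by omega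
  have hrest : ∀ y, y ≠ z → (c y).card ≤ 1 := by
    intro y hy
    by_cases hyw : y = w
    · rw [hyw, hcw]; exact zero_le_one
    have h0 : ∑ y ∈ (Finset.univ.erase w).erase z, ((c y).card - 1) = 0 := by omega
    have := Finset.sum_eq_zero_iff.1 h0 y (by simp [hy, hyw])
    omega
  obtain ⟨e₁, e₂, h12, hcz⟩ := Finset.card_eq_two.1 hz2
  have h1 := (hmemc z e₁).1 (by rw [hcz]; simp)
  have h2 := (hmemc z e₂).1 (by rw [hcz]; simp)
  have huniq : ∀ y, y ≠ z → ∀ e ∈ G.edges, ∀ e' ∈ G.edges,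
      y ∈ e → y ≠ p e → y ∈ e' → y ≠ p e' → e = e' := fun y hy e he e' he' a b a' b' =>
    Finset.card_le_one.1 (hrest y hy) e ((hmemc y e).2 ⟨he, a, b⟩) e' ((hmemc y e').2 ⟨he', a', b'⟩)
  refine ⟨p, z, e₁, e₂, fun e he => (hp e he).1, hpw, ?_, h1.1, h2.1, h12, h1.2.1, h2.2.1, h1.2.2,
    h2.2.2, ?_, huniq, ?_⟩
  · intro y hy
    obtain ⟨e, he, hye, hlt⟩ := hcov y hy
    exact ⟨e, he, hye, hpne hlt⟩
  · intro e he hze hzp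
    have : e ∈ c z := (hmemc z e).2 ⟨he, hze, hzp⟩
    rw [hcz] at this
    simpa using this
  · intro e he e' he' hpe hpp hpe'
    by_contra hz
    have hw : p e ≠ w := fun h => hpp (h.trans (hpw e' he' (h ▸ hpe)).symm)
    obtain ⟨g, hg, hpg, hlt⟩ := hcov _ hw
    have : g = e' := huniq _ hz g hg e' he' hpg (hpne hlt) hpe hpp
    -- The edge covering `p e` has a parent strictly closer to `w` than `p e`, although `p e` is
    -- nearest among the vertices of `e`, which include that parent.
    subst this
    exact absurd ((hp e he).2 _ hpe') (not_le.2 hlt)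

/-! ### Replacing one vertex of an edge. -/

section EdgeMove

variable {V : Type*} [DecidableEq V] {x : V → ℝ} {e : Finset V} {a b y : V}

theorem card_insert_erase (ha : a ∈ e) (hb : b ∉ e.erase a) :
    (insert b (e.erase a)).card = e.card := by
  rw [Finset.card_insert_of_notMem hb, Finset.card_erase_add_one ha]

/-- The form is the sum of products over ordered pairs of distinct vertices of `e`; only the pairs
involving the replaced vertex change, each counted twice. -/
theorem edgeForm_insert_erase (ha : a ∈ e) (hb : b ∉ e.erase a) :
    edgeForm x (insert b (e.erase a)) =
      edgeForm x e + 2 * ((x b - x a) * ∑ v ∈ e.erase a, x v) := by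
  unfold edgeForm
  rw [Finset.sum_insert hb, Finset.sum_insert hb, ← Finset.add_sum_erase e x ha,
    ← Finset.add_sum_erase e (fun v => x v ^ 2) ha]
  ring

theorem edgeForm_le_insert_erase (hpos : ∀ v, 0 < x v) (ha : a ∈ e) (hb : b ∉ e.erase a)
    (hab : x a ≤ x b) : edgeForm x e ≤ edgeForm x (insert b (e.erase a)) := by
  rw [edgeForm_insert_erase ha hb]
  have : 0 ≤ ∑ v ∈ e.erase a, x v := Finset.sum_nonneg fun v _ => (hpos v).le
  nlinarith [mul_nonneg (sub_nonneg.2 hab) this]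

theorem edgeRow_of_notMem (hy : y ∉ e) : edgeRow x e y = 0 := if_neg hy

theorem edgeRow_of_mem (hy : y ∈ e) : edgeRow x e y = ∑ v ∈ e, x v - x y := by
  rw [edgeRow, if_pos hy, Finset.sum_erase_eq_sub hy]

theorem edgeRow_insert_erase_self (hb : b ∉ e.erase a) :
    edgeRow x (insert b (e.erase a)) b = ∑ v ∈ e.erase a, x v := by
  rw [edgeRow, if_pos (Finset.mem_insert_self _ _), Finset.erase_insert hb]

theorem edgeRow_insert_erase_of_mem (ha : a ∈ e) (hb : b ∉ e.erase a) (hy : y ∈ e)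
    (hya : y ≠ a) : edgeRow x (insert b (e.erase a)) y = edgeRow x e y + (x b - x a) := by
  rw [edgeRow_of_mem (by simp [hy, hya]), edgeRow_of_mem hy, Finset.sum_insert hb,
    Finset.sum_erase_eq_sub ha]
  ring

theorem sum_erase_pos (hpos : ∀ v, 0 < x v) (he : 2 ≤ e.card) (ha : a ∈ e) :
    0 < ∑ v ∈ e.erase a, x v := by
  refine Finset.sum_pos (fun v _ => hpos v) (Finset.card_pos.1 ?_)
  rw [Finset.card_erase_of_mem ha]
  omega

theorem edgeRow_lt_insert_erase (hpos : ∀ v, 0 < x v) (he : 2 ≤ e.card) (ha : a ∈ e)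
    (hb : b ∉ e) : edgeRow x e b < edgeRow x (insert b (e.erase a)) b := by
  rw [edgeRow_of_notMem hb, edgeRow_insert_erase_self fun h => hb (Finset.mem_of_mem_erase h)]
  exact sum_erase_pos hpos he ha

theorem edgeRow_le_insert_erase (hpos : ∀ v, 0 < x v) (ha : a ∈ e) (hb : b ∉ e.erase a)
    (hab : x a ≤ x b) (hya : y ≠ a) :
    edgeRow x e y ≤ edgeRow x (insert b (e.erase a)) y := by
  by_cases hy : y ∈ e
  · rw [edgeRow_insert_erase_of_mem ha hb hy hya]
    linarith
  · rw [edgeRow_of_notMem hy, edgeRow]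
    split_ifs
    · exact Finset.sum_nonneg fun v _ => (hpos v).le
    · rfl

end EdgeMove

section Rooted

variable {V : Type*} [DecidableEq V] {G : FinHypergraph V} {x : V → ℝ} {w y z : V}
  {p : Finset V → V} {e f e₁ e₂ : Finset V}

theorem RootedAt.notMem_erase (h : G.RootedAt w p z e₁ e₂) (he : e ∈ G.edges) :
    w ∉ e.erase (p e) := fun hw =>
  (Finset.mem_erase.1 hw).1 (h.parent_eq e he (Finset.mem_of_mem_erase hw)).symm

theorem RootedAt.insert_erase_eq (h : G.RootedAt w p z e₁ e₂) (he : e ∈ G.edges)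
    (hp : p e = w) : insert w (e.erase (p e)) = e := by
  rw [← hp]
  exact Finset.insert_erase (h.parent_mem e he)

theorem RootedAt.edgeRow_lt (h : G.RootedAt w p z e₁ e₂) (hpos : ∀ v, 0 < x v)
    (he : e ∈ G.edges) (hp : p e ≠ w) :
    edgeRow x e w < edgeRow x (insert w (e.erase (p e))) w :=
  edgeRow_lt_insert_erase hpos (G.two_le_card e he) (h.parent_mem e he) fun hw =>
    hp (h.parent_eq e he hw)

theorem RootedAt.edgeRow_le (h : G.RootedAt w p z e₁ e₂) (hpos : ∀ v, 0 < x v)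
    (he : e ∈ G.edges) :
    edgeRow x e w ≤ edgeRow x (insert w (e.erase (p e))) w := by
  by_cases hp : p e = w
  · rw [h.insert_erase_eq he hp]
  · exact (h.edgeRow_lt hpos he hp).le

/-- All edges of `G` except for `f` are moved to the root `w`. -/
def towardsRoot (p : Finset V → V) (w : V) (f e : Finset V) : Finset V :=
  if e = f then f else insert w (e.erase (p e))

theorem towardsRoot_of_ne (he : e ≠ f) :
    towardsRoot p w f e = insert w (e.erase (p e)) := if_neg he

theorem towardsRoot_self : towardsRoot p w f f = f := if_pos rfl

theorem mem_towardsRoot (hy : y ∈ e) (hyp : y ≠ p e) :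
    y ∈ towardsRoot p w f e := by
  unfold towardsRoot
  split_ifs with h
  · exact h ▸ hy
  · simp [hy, hyp]

theorem root_mem_towardsRoot (he : e ≠ f) : w ∈ towardsRoot p w f e := by
  rw [towardsRoot_of_ne he]
  exact Finset.mem_insert_self _ _

theorem RootedAt.card_towardsRoot (h : G.RootedAt w p z e₁ e₂) (he : e ∈ G.edges) :
    (towardsRoot p w f e).card = e.card := by
  unfold towardsRoot
  split_ifs with hef
  · rw [hef]
  · exact card_insert_erase (h.parent_mem e he) (h.notMem_erase he)

theorem RootedAt.edgeForm_le_towardsRoot (h : G.RootedAt w p z e₁ e₂) (hpos : ∀ v, 0 < x v)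
    (hmax : ∀ v, x v ≤ x w) (he : e ∈ G.edges) :
    edgeForm x e ≤ edgeForm x (towardsRoot p w f e) := by
  unfold towardsRoot
  split_ifs with hef
  · rw [hef]
  · exact edgeForm_le_insert_erase hpos (h.parent_mem e he) (h.notMem_erase he) (hmax _)

theorem RootedAt.edgeRow_le_towardsRoot (h : G.RootedAt w p z e₁ e₂) (hpos : ∀ v, 0 < x v)
    (he : e ∈ G.edges) : edgeRow x e w ≤ edgeRow x (towardsRoot p w f e) w := by
  unfold towardsRoot
  split_ifs with hef
  · rw [hef]
  · exact h.edgeRow_le hpos he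

end Rooted

/-! ### Comparison with U* and F by moving edges. -/

section Comparison

open Matrix

variable {V : Type*} [Fintype V] [DecidableEq V] {G : FinHypergraph V} {k n : ℕ} {x : V → ℝ}
  {Φ : Finset V → Finset V} {w v y : V} {c₁ c₂ f : Finset V}

/-- The spectral radius grows when the edges of a hypergraph are replaced so that the quadratic
form at the Perron vector does not decrease. -/
theorem rho_lt_rho_of_image {W : Type*} [Fintype W] [DecidableEq W] {F : FinHypergraph W}
    (hk : 2 ≤ k) (hGu : G.IsUniform k) (hpos : ∀ v, 0 < x v)
    (hx : G.adjMatrix *ᵥ x = G.rho • x) (hΦ : ∀ e ∈ G.edges, (Φ e).card = k)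
    (hF : ∀ H : FinHypergraph V, H.IsUniform k → H.edges = G.edges.image Φ → H.Isomorphic F)
    (hFc : F.edges.card = G.edges.card)
    (hform : ∑ e ∈ G.edges, edgeForm x e ≤ ∑ e ∈ G.edges, edgeForm x (Φ e))
    (hy : ∑ e ∈ G.edges, edgeRow x e y < ∑ e ∈ G.edges, edgeRow x (Φ e) y) :
    G.rho < F.rho := by
  have hu : ∀ e ∈ G.edges.image Φ, e.card = k := by
    intro e he
    obtain ⟨d, hd, rfl⟩ := Finset.mem_image.1 he
    exact hΦ d hd
  let H : FinHypergraph V := ⟨G.edges.image Φ, fun e he => by rw [hu e he]; exact hk⟩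
  have hiso : H.Isomorphic F := hF H hu rfl
  -- Moved edges stay distinct for free: the image has as many edges as `F`, hence as many as `G`.
  have hinj : Set.InjOn Φ G.edges := by
    rw [← Finset.card_image_iff, ← hFc]
    exact hiso.card_edges_eq
  rw [← hiso.rho_eq]
  refine rho_lt_rho_of_edgeForm_le (H := H) hk hGu hu hpos hx ?_ (y := y) ?_
  · change _ ≤ ∑ e ∈ G.edges.image Φ, _
    rwa [Finset.sum_image hinj]
  · change _ < ∑ e ∈ G.edges.image Φ, _
    rwa [Finset.sum_image hinj]

/-- Here `w` and `v` become the two vertices common to the cycle edges `Φ c₁` and `Φ c₂`, while `Φ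
f` becomes the single pendant edge at `v`. -/
theorem rho_lt_hyperF (hk : 3 ≤ k) (hG : G.IsUnicyclic k) (hn : Fintype.card V = n)
    (hpos : ∀ v, 0 < x v) (hx : G.adjMatrix *ᵥ x = G.rho • x)
    (hΦ : ∀ e ∈ G.edges, (Φ e).card = k) (hwv : w ≠ v)
    (h₁ : c₁ ∈ G.edges) (h₂ : c₂ ∈ G.edges) (hf : f ∈ G.edges)
    (h₁₂ : c₁ ≠ c₂) (h₁f : c₁ ≠ f) (h₂f : c₂ ≠ f)
    (hv₁ : v ∈ Φ c₁) (hv₂ : v ∈ Φ c₂) (hvf : v ∈ Φ f)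
    (hw : ∀ e ∈ G.edges, e ≠ f → w ∈ Φ e) (hcov : ∀ y, ∃ e ∈ G.edges, y ∈ Φ e)
    (hform : ∑ e ∈ G.edges, edgeForm x e ≤ ∑ e ∈ G.edges, edgeForm x (Φ e))
    (hy : ∑ e ∈ G.edges, edgeRow x e y < ∑ e ∈ G.edges, edgeRow x (Φ e) y) :
    G.rho < (hyperF k n hk).rho := by
  have hm : n = (k - 1) * G.edges.card := hn ▸ hG.card_eq (by omega)
  refine rho_lt_rho_of_image (by omega) hG.2.1 hpos hx hΦ (fun H hH hHe =>
    isomorphic_hyperF hk hH hn hm rfl hHe hwv h₁ h₂ hf h₁₂ h₁f h₂f hv₁ hv₂ hvf hw hcov) ?_ hform hy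
  have h3 : 3 ≤ G.edges.card := by
    rw [← Finset.card_eq_three.2 ⟨_, _, _, h₁₂, h₁f, h₂f, rfl⟩]
    refine Finset.card_le_card fun e he => ?_
    simp only [Finset.mem_insert, Finset.mem_singleton] at he
    rcases he with rfl | rfl | rfl <;> assumption
  rw [hyperF, card_edges_attach_twoCycle]
  simp only [Fintype.card_sum, Fintype.card_fin]
  rw [hm, Nat.mul_div_cancel_left _ (by omega)]
  omega

variable {p : Finset V → V} {z : V} {e₁ e₂ : Finset V}

/-- With every parent replaced by `w`, the vertex `z` still lies in `e₁` and `e₂`, which gives U*.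
The edge `f` is new at `w`, so the row there grows strictly. -/
theorem RootedAt.rho_lt_uStar (h : G.RootedAt w p z e₁ e₂) (hk : 3 ≤ k) (hG : G.IsUnicyclic k)
    (hn : Fintype.card V = n) (hpos : ∀ v, 0 < x v) (hx : G.adjMatrix *ᵥ x = G.rho • x)
    (hmax : ∀ v, x v ≤ x w) (hf : f ∈ G.edges) (hpf : p f ≠ w) :
    G.rho < (uStar k n hk).rho := by
  have hm : n = (k - 1) * G.edges.card := hn ▸ hG.card_eq (by omega)
  refine rho_lt_rho_of_image (Φ := fun e => insert w (e.erase (p e))) (y := w) (by omega) hG.2.1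
    hpos hx (fun e he => ?_) (fun H hH hHe =>
      isomorphic_uStar hk hH hn hm rfl hHe h.z_ne_root.symm h.mem₁ h.mem₂ h.ne ?_ ?_ ?_ ?_) ?_ ?_ ?_
  · rw [card_insert_erase (h.parent_mem e he) (h.notMem_erase he), hG.2.1 e he]
  · simp [h.z_ne₁, h.z_mem₁]
  · simp [h.z_ne₂, h.z_mem₂]
  · simp
  · intro y
    by_cases hy : y = w
    · exact ⟨e₁, h.mem₁, by simp [hy]⟩
    · obtain ⟨e, he, hye, hyp⟩ := h.cover y hy
      exact ⟨e, he, by simp [hye, hyp]⟩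
  · have h2 : 2 ≤ G.edges.card := by
      rw [← Finset.card_pair h.ne]
      refine Finset.card_le_card fun e he => ?_
      simp only [Finset.mem_insert, Finset.mem_singleton] at he
      rcases he with rfl | rfl
      · exact h.mem₁
      · exact h.mem₂
    rw [uStar, card_edges_attach_twoCycle, Fintype.card_fin, hm,
      Nat.mul_div_cancel_left _ (by omega)]
    omega
  · exact Finset.sum_le_sum fun e he => edgeForm_le_insert_erase hpos (h.parent_mem e he)
      (h.notMem_erase he) (hmax _)
  · exact Finset.sum_lt_sum (fun e he => h.edgeRow_le hpos he) ⟨f, hf, h.edgeRow_lt hpos hf hpf⟩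

theorem RootedAt.isomorphic_uStar (h : G.RootedAt w p z e₁ e₂) (hk : 3 ≤ k)
    (hG : G.IsUnicyclic k) (hn : Fintype.card V = n) (hp : ∀ e ∈ G.edges, p e = w) :
    G.Isomorphic (uStar k n hk) := by
  have hm : n = (k - 1) * G.edges.card := hn ▸ hG.card_eq (by omega)
  have hw : ∀ e ∈ G.edges, w ∈ e := fun e he => by
    rw [← hp e he]; exact h.parent_mem e he
  refine FinHypergraph.isomorphic_uStar hk hG.2.1 hn hm rfl Finset.image_id.symm h.z_ne_root.symm
    h.mem₁ h.mem₂ h.ne h.z_mem₁ h.z_mem₂ hw fun y => ?_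
  by_cases hy : y = w
  · exact ⟨e₁, h.mem₁, hy ▸ hw _ h.mem₁⟩
  · obtain ⟨e, he, hye, -⟩ := h.cover y hy
    exact ⟨e, he, hye⟩

/-- Move all edges except for `f` to the root `w`; then replace the vertex `a` of the edge `j`
by the vertex `b`. -/
theorem RootedAt.rho_lt_hyperF_of_move (h : G.RootedAt w p z e₁ e₂) (hk : 3 ≤ k)
    (hG : G.IsUnicyclic k) (hn : Fintype.card V = n) (hpos : ∀ v, 0 < x v)
    (hx : G.adjMatrix *ᵥ x = G.rho • x) (hmax : ∀ v, x v ≤ x w)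
    (hf : f ∈ G.edges) {j : Finset V} (hj : j ∈ G.edges) {a b : V}
    (ha : a ∈ towardsRoot p w f j) (hb : b ∉ (towardsRoot p w f j).erase a) (hab : x a ≤ x b)
    (haw : a ≠ w) (hbw : b ≠ w)
    (hstrict : b ∉ towardsRoot p w f j ∨ ∃ e ∈ G.edges, e ≠ f ∧ p e ≠ w)
    (h₁ : c₁ ∈ G.edges) (h₂ : c₂ ∈ G.edges)
    (h₁₂ : c₁ ≠ c₂) (h₁f : c₁ ≠ f) (h₂f : c₂ ≠ f)
    (hb₁ : c₁ ≠ j → b ∈ towardsRoot p w f c₁)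
    (hb₂ : c₂ ≠ j → b ∈ towardsRoot p w f c₂)
    (hbf : f ≠ j → b ∈ f)
    (hacov : ∃ e ∈ G.edges, e ≠ j ∧ a ∈ towardsRoot p w f e) :
    G.rho < (hyperF k n hk).rho := by
  let T := towardsRoot p w f
  let Φ : Finset V → Finset V := Function.update T j (insert b ((T j).erase a))
  have hΦj : Φ j = insert b ((T j).erase a) := Function.update_self ..
  have hΦ : ∀ {e}, e ≠ j → Φ e = T e := fun he => Function.update_of_ne he ..
  have hbΦ : ∀ {e}, (e ≠ j → b ∈ T e) → b ∈ Φ e := fun {e} he => by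
    by_cases hej : e = j
    · rw [hej, hΦj]; exact Finset.mem_insert_self _ _
    · rw [hΦ hej]; exact he hej
  have hmem : ∀ {e y}, y ≠ a → y ∈ T e → y ∈ Φ e := fun {e y} hya hy => by
    by_cases hej : e = j
    · subst hej
      rw [hΦj]
      exact Finset.mem_insert_of_mem (Finset.mem_erase.2 ⟨hya, hy⟩)
    · rwa [hΦ hej]
  have hform : ∀ e ∈ G.edges, edgeForm x (T e) ≤ edgeForm x (Φ e) := fun e he => by
    by_cases hej : e = j
    · subst hej
      rw [hΦj]
      exact edgeForm_le_insert_erase hpos ha hb hab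
    · rw [hΦ hej]
  have hrow : ∀ e ∈ G.edges, ∀ y, y ≠ a → edgeRow x (T e) y ≤ edgeRow x (Φ e) y :=
    fun e he y hy => by
      by_cases hej : e = j
      · subst hej
        rw [hΦj]
        exact edgeRow_le_insert_erase hpos ha hb hab hy
      · rw [hΦ hej]
  have hcardT : ∀ e ∈ G.edges, (T e).card = k := fun e he =>
    (h.card_towardsRoot he).trans (hG.2.1 e he)
  -- If some edge really moves to `w`, the row at `w` grows. Otherwise only the replacement of `a`
  -- by `b` remains, and the row at `b` grows because `b` is new in `j`.
  obtain ⟨y, hy⟩ : ∃ y, ∑ e ∈ G.edges, edgeRow x e y < ∑ e ∈ G.edges, edgeRow x (Φ e) y := by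
    by_cases hex : ∃ e ∈ G.edges, e ≠ f ∧ p e ≠ w
    · obtain ⟨e, he, hef, hpe⟩ := hex
      refine ⟨w, Finset.sum_lt_sum (fun e he => (h.edgeRow_le_towardsRoot hpos he).trans
        (hrow e he w haw.symm)) ⟨e, he, lt_of_lt_of_le ?_ (hrow e he w haw.symm)⟩⟩
      change _ < edgeRow x (towardsRoot p w f e) w
      rw [towardsRoot_of_ne hef]
      exact h.edgeRow_lt hpos he hpe
    · have hTid : ∀ e ∈ G.edges, T e = e := fun e he => by
        by_cases hef : e = f
        · rw [hef]; exact towardsRoot_self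
        · refine (towardsRoot_of_ne hef).trans (h.insert_erase_eq he ?_)
          by_contra hpe
          exact hex ⟨e, he, hef, hpe⟩
      have hbj := hstrict.resolve_right hex
      have hba : b ≠ a := fun hba => hbj (hba ▸ ha)
      refine ⟨b, Finset.sum_lt_sum (fun e he => ?_) ⟨j, hj, ?_⟩⟩
      · conv_lhs => rw [← hTid e he]
        exact hrow e he b hba
      · conv_lhs => rw [← hTid j hj]
        rw [hΦj]
        exact edgeRow_lt_insert_erase hpos (by rw [hcardT j hj]; omega) ha hbj
  refine rho_lt_hyperF hk hG hn hpos hx (Φ := Φ) (fun e he => ?_) hbw.symm h₁ h₂ hf h₁₂ h₁f h₂f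
    (hbΦ hb₁) (hbΦ hb₂) (hbΦ fun hfj => ?_) (fun e _ hef => hmem haw.symm (root_mem_towardsRoot hef))
    (fun y => ?_) (Finset.sum_le_sum fun e he =>
      (h.edgeForm_le_towardsRoot hpos hmax he).trans (hform e he)) hy
  · by_cases hej : e = j
    · subst hej
      rw [hΦj, card_insert_erase ha hb, hcardT e he]
    · rw [hΦ hej, hcardT e he]
  · change b ∈ towardsRoot p w f f
    rw [towardsRoot_self]
    exact hbf hfj
  · by_cases hya : y = a
    · obtain ⟨e, he, hej, hae⟩ := hacov
      exact ⟨e, he, by rw [hΦ hej, hya]; exact hae⟩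
    by_cases hyw : y = w
    · exact ⟨c₁, h₁, hmem hya (hyw ▸ root_mem_towardsRoot h₁f)⟩
    · obtain ⟨e, he, hye, hyp⟩ := h.cover y hyw
      exact ⟨e, he, hmem hya (mem_towardsRoot hye hyp)⟩

/-- Replace the vertex `a` of the edge `i` by `b`, and the vertex `a'` of the edge `j` by `b'`. -/
theorem rho_lt_hyperF_of_two_moves (hk : 3 ≤ k) (hG : G.IsUnicyclic k)
    (hn : Fintype.card V = n) (hpos : ∀ v, 0 < x v) (hx : G.adjMatrix *ᵥ x = G.rho • x)
    {i j : Finset V} (hi : i ∈ G.edges) (hj : j ∈ G.edges) (hij : i ≠ j) {a b a' b' : V}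
    (ha : a ∈ i) (hb : b ∉ i) (ha' : a' ∈ j) (hb' : b' ∉ j)
    (hform : 0 ≤ (x b - x a) * ∑ u ∈ i.erase a, x u + (x b' - x a') * ∑ u ∈ j.erase a', x u)
    (hrow : edgeRow x i y + edgeRow x j y <
      edgeRow x (insert b (i.erase a)) y + edgeRow x (insert b' (j.erase a')) y)
    (hwv : w ≠ v) (h₁ : c₁ ∈ G.edges) (h₂ : c₂ ∈ G.edges) (hf : f ∈ G.edges)
    (h₁₂ : c₁ ≠ c₂) (h₁f : c₁ ≠ f) (h₂f : c₂ ≠ f)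
    (hΦ : ∀ Φ : Finset V → Finset V, Φ i = insert b (i.erase a) → Φ j = insert b' (j.erase a') →
      (∀ e, e ≠ i → e ≠ j → Φ e = e) → v ∈ Φ c₁ ∧ v ∈ Φ c₂ ∧ v ∈ Φ f ∧
        (∀ e ∈ G.edges, e ≠ f → w ∈ Φ e) ∧ ∀ y, ∃ e ∈ G.edges, y ∈ Φ e) :
    G.rho < (hyperF k n hk).rho := by
  let Φ : Finset V → Finset V := fun e =>
    if e = i then insert b (i.erase a) else if e = j then insert b' (j.erase a') else e
  have hΦi : Φ i = insert b (i.erase a) := if_pos rfl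
  have hΦj : Φ j = insert b' (j.erase a') := by simp [Φ, hij.symm]
  have hΦe : ∀ e, e ≠ i → e ≠ j → Φ e = e := fun e h1 h2 => by simp [Φ, h1, h2]
  have hbi : b ∉ i.erase a := fun h => hb (Finset.mem_of_mem_erase h)
  have hbj : b' ∉ j.erase a' := fun h => hb' (Finset.mem_of_mem_erase h)
  have hsub : ({i, j} : Finset (Finset V)) ⊆ G.edges := by
    intro e he
    simp only [Finset.mem_insert, Finset.mem_singleton] at he
    rcases he with rfl | rfl <;> assumption
  -- Stated for arbitrary `q` to serve both the quadratic forms and the rows at `y`.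
  have hsum : ∀ q : Finset V → ℝ, ∑ e ∈ G.edges, q (Φ e) - ∑ e ∈ G.edges, q e =
      (q (insert b (i.erase a)) - q i) + (q (insert b' (j.erase a')) - q j) := by
    intro q
    rw [← Finset.sum_sub_distrib, ← Finset.sum_subset hsub, Finset.sum_pair hij, hΦi, hΦj]
    intro e _ he
    simp only [Finset.mem_insert, Finset.mem_singleton, not_or] at he
    rw [hΦe e he.1 he.2, sub_self]
  obtain ⟨hv₁, hv₂, hvf, hw, hcov⟩ := hΦ Φ hΦi hΦj hΦe
  refine rho_lt_hyperF hk hG hn hpos hx (fun e he => ?_) hwv h₁ h₂ hf h₁₂ h₁f h₂f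
    hv₁ hv₂ hvf hw hcov ?_ (y := y) ?_
  · by_cases hei : e = i
    · subst hei
      rw [hΦi, card_insert_erase ha hbi, hG.2.1 e he]
    by_cases hej : e = j
    · subst hej
      rw [hΦj, card_insert_erase ha' hbj, hG.2.1 e he]
    rw [hΦe e hei hej, hG.2.1 e he]
  · have := hsum (edgeForm x)
    rw [edgeForm_insert_erase ha hbi, edgeForm_insert_erase ha' hbj] at this
    linarith
  · have := hsum fun e => edgeRow x e y
    linarith

/-- The hypercycle of length two with all pendant edges attached at a vertex of degree one. -/
theorem rho_lt_hyperF_of_root_notMem (hk : 3 ≤ k) (hG : G.IsUnicyclic k)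
    (hn : Fintype.card V = n) (hpos : ∀ v, 0 < x v) (hx : G.adjMatrix *ᵥ x = G.rho • x)
    (hmax : ∀ v, x v ≤ x w) {e₃ : Finset V} {t u : V}
    (h₁ : e₁ ∈ G.edges) (h₂ : e₂ ∈ G.edges) (h₃ : e₃ ∈ G.edges)
    (h₁₂ : e₁ ≠ e₂) (h₁₃ : e₁ ≠ e₃) (h₂₃ : e₂ ≠ e₃)
    (hu₁ : u ∈ e₁) (hu₂ : u ∈ e₂) (hu₃ : u ∉ e₃) (hz₁ : z ∈ e₁) (hz₂ : z ∈ e₂) (hz₃ : z ∉ e₃)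
    (ht₁ : t ∉ e₁) (ht₂ : t ∉ e₂) (ht₃ : t ∈ e₃) (huz : u ≠ z) (htw : t ≠ w) (hw₂ : w ∉ e₂)
    (hw : ∀ e ∈ G.edges, e ≠ e₂ → w ∈ e) (hcov : ∀ y, ∃ e ∈ G.edges, y ∈ e)
    (huzx : x u ≤ x z) : G.rho < (hyperF k n hk).rho := by
  have hw₁ := hw e₁ h₁ h₁₂
  have hw₃ := hw e₃ h₃ h₂₃.symm
  have hzw : z ≠ w := fun h => hw₂ (h ▸ hz₂)
  have huw : u ≠ w := fun h => hw₂ (h ▸ hu₂)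
  have htu : t ≠ u := fun h => ht₁ (h ▸ hu₁)
  have htz : t ≠ z := fun h => ht₁ (h ▸ hz₁)
  have hS : ∀ {e : Finset V}, e ∈ G.edges → ∀ {a}, a ∈ e → 0 < ∑ v ∈ e.erase a, x v :=
    fun {e} he {a} ha => sum_erase_pos hpos (G.two_le_card e he) ha
  rcases le_total (x z) (x t) with hzt | htz'
  -- Both `z` in `e₁` and `u` in `e₂` become `t`: now `e₃` and `e₁` share `w` and `t`, and `e₂`
  -- hangs at `t`.
  · refine rho_lt_hyperF_of_two_moves hk hG hn hpos hx h₁ h₂ h₁₂ hz₁ ht₁ hu₂ ht₂ ?_ (y := t) ?_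
      htw.symm h₃ h₁ h₂ h₁₃.symm h₂₃.symm h₁₂ fun Φ hΦ₁ hΦ₂ hΦ => ⟨?_, ?_, ?_, ?_, fun y => ?_⟩
    · have := mul_nonneg (sub_nonneg.2 hzt) (hS h₁ hz₁).le
      have := mul_nonneg (sub_nonneg.2 (huzx.trans hzt)) (hS h₂ hu₂).le
      linarith
    · exact add_lt_add (edgeRow_lt_insert_erase hpos (G.two_le_card _ h₁) hz₁ ht₁)
        (edgeRow_lt_insert_erase hpos (G.two_le_card _ h₂) hu₂ ht₂)
    · rwa [hΦ e₃ h₁₃.symm h₂₃.symm]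
    · simp [hΦ₁]
    · simp [hΦ₂]
    · intro e he he₂
      by_cases he₁ : e = e₁
      · subst he₁
        simp [hΦ₁, hw₁, hzw.symm]
      · rw [hΦ e he₁ he₂]
        exact hw e he he₂
    · by_cases hyz : y = z
      · exact ⟨e₂, h₂, by simp [hΦ₂, hyz, hz₂, huz.symm]⟩
      by_cases hyu : y = u
      · exact ⟨e₁, h₁, by simp [hΦ₁, hyu, hu₁, huz]⟩
      obtain ⟨e, he, hye⟩ := hcov y
      refine ⟨e, he, ?_⟩
      by_cases he₁ : e = e₁
      · subst he₁; simp [hΦ₁, hyz, hye]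
      by_cases he₂ : e = e₂
      · subst he₂; simp [hΦ₂, hyu, hye]
      rwa [hΦ e he₁ he₂]
  -- With `z` heavier than `t`, the edge `e₃` receives `z` and gives `t` or `w` to `e₂` in place of
  -- `u`. One factor of the change may be negative; comparing these sums decides which exchange has
  -- a nonnegative total.
  rcases le_total (∑ v ∈ e₂.erase u, x v) (∑ v ∈ e₃.erase w, x v) with hle | hle
  -- Exchange through `t`: `e₁` and `e₃` share `w` and `z`, and `e₂` hangs at `z`.
  · refine rho_lt_hyperF_of_two_moves hk hG hn hpos hx h₂ h₃ h₂₃ hu₂ ht₂ ht₃ hz₃ ?_ (y := z) ?_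
      hzw.symm h₁ h₃ h₂ h₁₃ h₁₂ h₂₃.symm fun Φ hΦ₂ hΦ₃ hΦ => ⟨?_, ?_, ?_, ?_, fun y => ?_⟩
    · have h4 : ∑ v ∈ e₂.erase u, x v ≤ ∑ v ∈ e₃.erase t, x v := by
        refine hle.trans ?_
        rw [Finset.sum_erase_eq_sub hw₃, Finset.sum_erase_eq_sub ht₃]
        linarith [hmax t]
      have h5 := hS h₂ hu₂
      nlinarith [mul_nonneg (sub_nonneg.2 htz') (sub_nonneg.2 h4),
        mul_nonneg (sub_nonneg.2 huzx) h5.le]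
    · rw [edgeRow_insert_erase_of_mem hu₂ (by simp [ht₂]) hz₂ huz.symm,
        edgeRow_of_notMem hz₃, edgeRow_insert_erase_self (by simp [hz₃])]
      have h6 : x w ≤ ∑ v ∈ e₃.erase t, x v :=
        Finset.single_le_sum (f := x) (fun v _ => (hpos v).le)
          (Finset.mem_erase.2 ⟨htw.symm, hw₃⟩)
      linarith [hmax u, hpos t]
    · rwa [hΦ e₁ h₁₂ h₁₃]
    · simp [hΦ₃]
    · simp [hΦ₂, hz₂, huz.symm]
    · intro e he he₂
      by_cases he₃ : e = e₃
      · subst he₃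
        simp [hΦ₃, hw₃, htw.symm]
      · rw [hΦ e he₂ he₃]
        exact hw e he he₂
    · by_cases hyu : y = u
      · exact ⟨e₁, h₁, by rwa [hΦ e₁ h₁₂ h₁₃, hyu]⟩
      by_cases hyt : y = t
      · exact ⟨e₂, h₂, by simp [hΦ₂, hyt]⟩
      obtain ⟨e, he, hye⟩ := hcov y
      refine ⟨e, he, ?_⟩
      by_cases he₂ : e = e₂
      · subst he₂; simp [hΦ₂, hyu, hye]
      by_cases he₃ : e = e₃
      · subst he₃; simp [hΦ₃, hyt, hye]
      rwa [hΦ e he₂ he₃]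
  -- Exchange through `w`: `e₁` and `e₂` share `w` and `z`, and now `e₃` hangs at `z`.
  · refine rho_lt_hyperF_of_two_moves hk hG hn hpos hx h₂ h₃ h₂₃ hu₂ hw₂ hw₃ hz₃ ?_ (y := z) ?_
      hzw.symm h₁ h₂ h₃ h₁₂ h₁₃ h₂₃ fun Φ hΦ₂ hΦ₃ hΦ => ⟨?_, ?_, ?_, ?_, fun y => ?_⟩
    · have h5 := hS h₂ hu₂
      nlinarith [mul_nonneg (sub_nonneg.2 (hmax z)) (sub_nonneg.2 hle),
        mul_nonneg (sub_nonneg.2 huzx) h5.le]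
    · rw [edgeRow_insert_erase_of_mem hu₂ (by simp [hw₂]) hz₂ huz.symm,
        edgeRow_of_notMem hz₃, edgeRow_insert_erase_self (by simp [hz₃])]
      linarith [hmax u, hS h₃ hw₃]
    · rwa [hΦ e₁ h₁₂ h₁₃]
    · simp [hΦ₂, hz₂, huz.symm]
    · simp [hΦ₃]
    · intro e he he₃
      by_cases he₂ : e = e₂
      · subst he₂
        simp [hΦ₂]
      · rw [hΦ e he₂ he₃]
        exact hw e he he₂
    · by_cases hyu : y = u
      · exact ⟨e₁, h₁, by rwa [hΦ e₁ h₁₂ h₁₃, hyu]⟩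
      by_cases hyw : y = w
      · exact ⟨e₁, h₁, by rwa [hΦ e₁ h₁₂ h₁₃, hyw]⟩
      obtain ⟨e, he, hye⟩ := hcov y
      refine ⟨e, he, ?_⟩
      by_cases he₂ : e = e₂
      · subst he₂; simp [hΦ₂, hyu, hye]
      by_cases he₃ : e = e₃
      · subst he₃; simp [hΦ₃, hyw, hye]
      rwa [hΦ e he₂ he₃]

end Comparison

/-! ### Case analysis on the edges whose parent is not the root. -/

section

open Matrix

variable {V : Type*} [Fintype V] [DecidableEq V] {G : FinHypergraph V} {k n : ℕ} {x : V → ℝ}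
  {w z : V} {p : Finset V → V} {e₁ e₂ f g : Finset V}

/-- Replacing `z` by `p f` in `e₂` makes `e₂` and `g` a 2-cycle through `w` and `p f`, with `f`
pendant at `p f`. The vertex `z` remains covered by `e₁`. -/
theorem RootedAt.rho_lt_hyperF_of_le_parent (h : G.RootedAt w p z e₁ e₂) (hk : 3 ≤ k)
    (hG : G.IsUnicyclic k) (hn : Fintype.card V = n) (hpos : ∀ v, 0 < x v)
    (hx : G.adjMatrix *ᵥ x = G.rho • x) (hmax : ∀ v, x v ≤ x w)
    (hf : f ∈ G.edges) (hpf : p f ≠ w) (hg : g ∈ G.edges) (hpg : p f ∈ g) (hpgne : p f ≠ p g)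
    (hpz : p f ≠ z) (h₂g : e₂ ≠ g) (h₂f : e₂ ≠ f) (hle : x z ≤ x (p f)) :
    G.rho < (hyperF k n hk).rho := by
  have hgf : g ≠ f := by rintro rfl; exact hpgne rfl
  have hb : p f ∉ towardsRoot p w f e₂ := by
    rw [towardsRoot_of_ne h₂f, Finset.mem_insert, Finset.mem_erase]
    rintro (h' | ⟨h1, h2⟩)
    · exact hpf h'
    · exact h₂g (h.unique _ hpz _ h.mem₂ _ hg h2 h1 hpg hpgne)
  refine h.rho_lt_hyperF_of_move hk hG hn hpos hx hmax hf h.mem₂ (a := z) (b := p f)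
    (mem_towardsRoot h.z_mem₂ h.z_ne₂) (fun h' => hb (Finset.mem_of_mem_erase h')) hle
    h.z_ne_root hpf (Or.inl hb) hg h.mem₂ h₂g.symm hgf h₂f
    (fun _ => mem_towardsRoot hpg hpgne) (fun h' => absurd rfl h') (fun _ => h.parent_mem f hf)
    ⟨e₁, h.mem₁, h.ne, mem_towardsRoot h.z_mem₁ h.z_ne₁⟩

/-- Replacing `p f` by `z` in `f` hangs `f` at `z`, next to the 2-cycle `e₁`, `e₂`. This changes
nothing exactly when `p f = z` and all other parents are `w`; then `G` already is F. -/
theorem RootedAt.rho_lt_hyperF_or_isomorphic_of_parent_le (h : G.RootedAt w p z e₁ e₂)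
    (hk : 3 ≤ k) (hG : G.IsUnicyclic k) (hn : Fintype.card V = n) (hpos : ∀ v, 0 < x v)
    (hx : G.adjMatrix *ᵥ x = G.rho • x) (hmax : ∀ v, x v ≤ x w)
    (hf : f ∈ G.edges) (hpf : p f ≠ w) (hg : g ∈ G.edges) (hpg : p f ∈ g) (hpgne : p f ≠ p g)
    (h₁f : e₁ ≠ f) (h₂f : e₂ ≠ f) (hle : x (p f) ≤ x z) :
    G.rho < (hyperF k n hk).rho ∨ G.Isomorphic (hyperF k n hk) := by
  have hgf : g ≠ f := by rintro rfl; exact hpgne rfl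
  have hzf : z ∉ f.erase (p f) := fun h' => by
    rcases h.eq_or_eq f hf (Finset.mem_of_mem_erase h') (Finset.mem_erase.1 h').1 with h' | h'
    · exact h₁f h'.symm
    · exact h₂f h'.symm
  by_cases hex : p f ≠ z ∨ ∃ e ∈ G.edges, e ≠ f ∧ p e ≠ w
  · left
    refine h.rho_lt_hyperF_of_move hk hG hn hpos hx hmax hf hf (a := p f) (b := z)
      ?_ ?_ hle hpf h.z_ne_root (hex.imp_left fun hpz => ?_) h.mem₁ h.mem₂ h.ne h₁f h₂f
      (fun _ => mem_towardsRoot h.z_mem₁ h.z_ne₁) (fun _ => mem_towardsRoot h.z_mem₂ h.z_ne₂)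
      (fun h' => absurd rfl h') ⟨g, hg, hgf, mem_towardsRoot hpg hpgne⟩
    · rw [towardsRoot_self]
      exact h.parent_mem f hf
    · rwa [towardsRoot_self]
    · rw [towardsRoot_self]
      exact fun h' => hzf (Finset.mem_erase.2 ⟨hpz.symm, h'⟩)
  · right
    push Not at hex
    obtain ⟨hpz, hall⟩ := hex
    have hw : ∀ e ∈ G.edges, e ≠ f → w ∈ e := fun e he hef => by
      rw [← hall e he hef]
      exact h.parent_mem e he
    refine isomorphic_hyperF hk hG.2.1 hn (hn ▸ hG.card_eq (by omega)) rfl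
      Finset.image_id.symm h.z_ne_root.symm h.mem₁ h.mem₂ hf h.ne h₁f h₂f h.z_mem₁ h.z_mem₂
      (hpz ▸ h.parent_mem f hf) hw fun y => ?_
    by_cases hy : y = w
    · exact ⟨e₁, h.mem₁, hy ▸ hw _ h.mem₁ h₁f⟩
    · obtain ⟨e, he, hye, -⟩ := h.cover y hy
      exact ⟨e, he, hye⟩

/-- The kept edge is `e₂` itself, which contains both `z` and `p e₂`. Whichever is heavier becomes
the second cycle vertex, and the 2-cycle consists of `g` and `e₁`. -/
theorem RootedAt.rho_lt_hyperF_of_cycle_edge (h : G.RootedAt w p z e₁ e₂)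
    (hk : 3 ≤ k) (hG : G.IsUnicyclic k) (hn : Fintype.card V = n) (hpos : ∀ v, 0 < x v)
    (hx : G.adjMatrix *ᵥ x = G.rho • x) (hmax : ∀ v, x v ≤ x w)
    (hp₂ : p e₂ ≠ w) (hg : g ∈ G.edges) (hpg : p e₂ ∈ g) (hpgne : p e₂ ≠ p g) (hg₁ : g ≠ e₁) :
    G.rho < (hyperF k n hk).rho := by
  have hg₂ : g ≠ e₂ := by rintro rfl; exact hpgne rfl
  rcases le_total (x z) (x (p e₂)) with hle | hle
  · exact h.symm.rho_lt_hyperF_of_le_parent hk hG hn hpos hx hmax h.mem₂ hp₂ hg hpg hpgne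
      h.z_ne₂.symm hg₁.symm h.ne hle
  · have hb : z ∉ towardsRoot p w e₂ g := by
      rw [towardsRoot_of_ne hg₂, Finset.mem_insert, Finset.mem_erase]
      rintro (h' | ⟨h1, h2⟩)
      · exact h.z_ne_root h'
      · rcases h.eq_or_eq g hg h2 h1 with h' | h'
        · exact hg₁ h'
        · exact hg₂ h'
    exact h.rho_lt_hyperF_of_move hk hG hn hpos hx hmax h.mem₂ hg (a := p e₂) (b := z)
      (mem_towardsRoot hpg hpgne) (fun h' => hb (Finset.mem_of_mem_erase h')) hle hp₂
      h.z_ne_root (Or.inl hb) hg h.mem₁ hg₁ hg₂ h.ne (fun h' => absurd rfl h')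
      (fun _ => mem_towardsRoot h.z_mem₁ h.z_ne₁) (fun _ => h.z_mem₂)
      ⟨e₂, h.mem₂, hg₂.symm, by rw [towardsRoot_self]; exact h.parent_mem _ h.mem₂⟩

theorem RootedAt.rho_lt_hyperF_of_forall_cycle_edge (h : G.RootedAt w p z e₁ e₂)
    (hk : 3 ≤ k) (hG : G.IsUnicyclic k) (hn : Fintype.card V = n) (hpos : ∀ v, 0 < x v)
    (hx : G.adjMatrix *ᵥ x = G.rho • x) (hmax : ∀ v, x v ≤ x w) (hm : 3 ≤ G.edges.card)
    (hp₂ : p e₂ ≠ w) (hall : ∀ e ∈ G.edges, p e ≠ w → e = e₁ ∨ e = e₂) :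
    G.rho < (hyperF k n hk).rho := by
  obtain ⟨g, hg, hpg, hpgne⟩ := h.cover _ hp₂
  by_cases hg₁ : g = e₁
  swap
  · exact h.rho_lt_hyperF_of_cycle_edge hk hG hn hpos hx hmax hp₂ hg hpg hpgne hg₁
  subst hg₁
  by_cases hp₁ : p g = w
  swap
  · obtain ⟨g', hg', hpg', hpgne'⟩ := h.cover _ hp₁
    refine h.symm.rho_lt_hyperF_of_cycle_edge hk hG hn hpos hx hmax hp₁ hg' hpg' hpgne' ?_
    rintro rfl
    -- The two cycle edges would hang from each other.
    exact h.z_ne₁ (h.acyclic g hg _ hg' hpg' hpgne' hpg).symm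
  have hw₂ : w ∉ e₂ := fun h' => hp₂ (h.parent_eq _ h.mem₂ h')
  have hp : ∀ e ∈ G.edges, e ≠ e₂ → p e = w := fun e he hne => by
    by_contra hpe
    rcases hall e he hpe with rfl | rfl
    · exact hpe hp₁
    · exact hne rfl
  have hw : ∀ e ∈ G.edges, e ≠ e₂ → w ∈ e := fun e he hne => by
    rw [← hp e he hne]
    exact h.parent_mem e he
  obtain ⟨e₃, he₃, hne⟩ : ∃ e ∈ G.edges, e ∉ ({g, e₂} : Finset (Finset V)) := by
    by_contra! hcon
    have := (Finset.card_le_card hcon).trans Finset.card_le_two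
    omega
  simp only [Finset.mem_insert, Finset.mem_singleton, not_or] at hne
  obtain ⟨h₃₁, h₃₂⟩ := hne
  have hp₃ := hp e₃ he₃ h₃₂
  obtain ⟨t, ht₃, htw⟩ := Finset.exists_mem_ne
    (lt_of_lt_of_le one_lt_two (G.two_le_card e₃ he₃)) w
  have hz₃ : z ∉ e₃ := fun h' => by
    rcases h.eq_or_eq e₃ he₃ h' (hp₃ ▸ h.z_ne_root) with h' | h'
    · exact h₃₁ h'
    · exact h₃₂ h'
  have hu₃ : p e₂ ∉ e₃ := fun h' =>
    h₃₁ (h.unique _ h.z_ne₂.symm _ he₃ _ hg h' (hp₃ ▸ hp₂) hpg hpgne)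
  have htz : t ≠ z := fun h' => hz₃ (h' ▸ ht₃)
  have ht₁ : t ∉ g := fun h' =>
    h₃₁ (h.unique t htz _ he₃ _ hg ht₃ (hp₃ ▸ htw) h' (hp₁ ▸ htw))
  have ht₂ : t ∉ e₂ := fun h' =>
    h₃₂ (h.unique t htz _ he₃ _ h.mem₂ ht₃ (hp₃ ▸ htw) h' fun h' => hu₃ (h' ▸ ht₃))
  have hcov : ∀ y, ∃ e ∈ G.edges, y ∈ e := fun y => by
    by_cases hy : y = w
    · exact ⟨g, hg, hy ▸ hw g hg h.ne⟩
    · obtain ⟨e, he, hye, -⟩ := h.cover y hy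
      exact ⟨e, he, hye⟩
  have hu₂ := h.parent_mem _ h.mem₂
  -- The vertices `z` and `p e₂` both lie in `g` and `e₂` and play symmetric roles, so either may be
  -- the heavier one.
  rcases le_total (x (p e₂)) (x z) with hle | hle
  · exact rho_lt_hyperF_of_root_notMem hk hG hn hpos hx hmax hg h.mem₂ he₃ h.ne (Ne.symm h₃₁)
      (Ne.symm h₃₂) hpg hu₂ hu₃ h.z_mem₁ h.z_mem₂ hz₃ ht₁ ht₂ ht₃ h.z_ne₂.symm htw hw₂ hw hcov hle
  · exact rho_lt_hyperF_of_root_notMem hk hG hn hpos hx hmax hg h.mem₂ he₃ h.ne (Ne.symm h₃₁)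
      (Ne.symm h₃₂) h.z_mem₁ h.z_mem₂ hz₃ hpg hu₂ hu₃ ht₁ ht₂ ht₃ h.z_ne₂ htw hw₂ hw hcov hle

/-- A Perron vector together with a rooting of the hypergraph at a vertex where it is maximal. -/
theorem IsUnicyclic.exists_perron_rootedAt (hk : 1 ≤ k) (hG : G.IsUnicyclic k) :
    ∃ (x : V → ℝ) (w : V) (p : Finset V → V) (z : V) (e₁ e₂ : Finset V),
      (∀ v, 0 < x v) ∧ G.adjMatrix *ᵥ x = G.rho • x ∧ (∀ v, x v ≤ x w) ∧
        G.RootedAt w p z e₁ e₂ := by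
  obtain ⟨x, hpos, hx⟩ := hG.1.exists_pos_eigenvector
  have := hG.1.1
  obtain ⟨w, hmax⟩ := Finite.exists_max x
  obtain ⟨p, z, e₁, e₂, h⟩ := hG.exists_rootedAt hk w
  exact ⟨x, w, p, z, e₁, e₂, hpos, hx, hmax, h⟩

theorem IsUnicyclic.rho_lt_uStar_or_isomorphic (hk : 3 ≤ k) (hG : G.IsUnicyclic k)
    (hn : Fintype.card V = n) :
    G.rho < (uStar k n hk).rho ∨ G.Isomorphic (uStar k n hk) := by
  obtain ⟨x, w, p, z, e₁, e₂, hpos, hx, hmax, h⟩ := hG.exists_perron_rootedAt (by omega)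
  by_cases hp : ∀ e ∈ G.edges, p e = w
  · exact Or.inr (h.isomorphic_uStar hk hG hn hp)
  · push Not at hp
    obtain ⟨f, hf, hpf⟩ := hp
    exact Or.inl (h.rho_lt_uStar hk hG hn hpos hx hmax hf hpf)

theorem IsUnicyclic.rho_lt_hyperF_or_isomorphic (hk : 3 ≤ k) (hG : G.IsUnicyclic k)
    (hn : Fintype.card V = n) (hm : 3 ≤ G.edges.card) (hU : ¬ G.Isomorphic (uStar k n hk)) :
    G.rho < (hyperF k n hk).rho ∨ G.Isomorphic (hyperF k n hk) := by
  obtain ⟨x, w, p, z, e₁, e₂, hpos, hx, hmax, h⟩ := hG.exists_perron_rootedAt (by omega)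
  have hp : ∃ f ∈ G.edges, p f ≠ w := by
    by_contra! hp
    exact hU (h.isomorphic_uStar hk hG hn hp)
  by_cases hall : ∀ e ∈ G.edges, p e ≠ w → e = e₁ ∨ e = e₂
  · obtain ⟨f, hf, hpf⟩ := hp
    left
    rcases hall f hf hpf with rfl | rfl
    · exact h.symm.rho_lt_hyperF_of_forall_cycle_edge hk hG hn hpos hx hmax hm hpf
        fun e he hpe => (hall e he hpe).symm
    · exact h.rho_lt_hyperF_of_forall_cycle_edge hk hG hn hpos hx hmax hm hpf hall
  · push Not at hall
    obtain ⟨f, hf, hpf, hf₁, hf₂⟩ := hall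
    obtain ⟨g, hg, hpg, hpgne⟩ := h.cover _ hpf
    rcases le_or_gt (x (p f)) (x z) with hle | hlt
    · exact h.rho_lt_hyperF_or_isomorphic_of_parent_le hk hG hn hpos hx hmax hf hpf hg hpg hpgne
        hf₁.symm hf₂.symm hle
    · left
      have hpz : p f ≠ z := fun h' => hlt.ne' (by rw [h'])
      by_cases hg₂ : e₂ = g
      · exact h.symm.rho_lt_hyperF_of_le_parent hk hG hn hpos hx hmax hf hpf hg hpg hpgne hpz
          (hg₂ ▸ h.ne) hf₁.symm hlt.le
      · exact h.rho_lt_hyperF_of_le_parent hk hG hn hpos hx hmax hf hpf hg hpg hpgne hpz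
          hg₂ hf₂.symm hlt.le

end

/-! ### Telling F from U*. -/

theorem Isomorphic.exists_mem_of_exists_mem {V W : Type*} {G : FinHypergraph V}
    {H : FinHypergraph W} (h : G.Isomorphic H) (hH : ∃ v, ∀ e ∈ H.edges, v ∈ e) :
    ∃ v, ∀ e ∈ G.edges, v ∈ e := by
  obtain ⟨f, hf⟩ := h
  obtain ⟨v, hv⟩ := hH
  refine ⟨f.symm v, fun e he => ?_⟩
  obtain ⟨u, hu, huv⟩ := Finset.mem_map.1 (hv _ ((hf e).1 he))
  rw [← huv]
  simpa using hu

theorem exists_mem_uStar {k n : ℕ} (hk : 3 ≤ k) : ∃ v, ∀ e ∈ (uStar k n hk).edges, v ∈ e := by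
  refine ⟨Sum.inl (Sum.inl 0), fun e he => ?_⟩
  rcases (mem_attach_twoCycle_edges hk).1 he with ⟨i, rfl⟩ | ⟨j, rfl⟩
  · simp [cycleEdge]
  · simp [pendantEdge]

/-- Pendant edges at both cycle vertices leave no common vertex. Four edges are needed: with three
there is no pendant edge at v₁, and v₂ lies in every edge. -/
theorem not_exists_mem_hyperF {k n : ℕ} (hk : 3 ≤ k) (hn : 4 ≤ n / (k - 1)) :
    ¬ ∃ v, ∀ e ∈ (hyperF k n hk).edges, v ∈ e := by
  rintro ⟨v, hv⟩
  have hC := fun i => hv _ ((mem_attach_twoCycle_edges hk).2 (Or.inl ⟨i, rfl⟩))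
  have hP := fun j => hv _ ((mem_attach_twoCycle_edges hk).2 (Or.inr ⟨j, rfl⟩))
  have h0 := hP (Sum.inl ⟨0, by omega⟩)
  have h1 := hP (Sum.inr 0)
  rcases v with (i | ⟨i, l⟩) | ⟨j, l⟩
  · simp only [pendantEdge, Sum.elim_inl, Sum.elim_inr, Finset.mem_insert, Finset.mem_image] at h0 h1
    simp_all
  · simp [pendantEdge] at h0
  · have := hC 0
    simp [cycleEdge] at this

theorem isUnicyclic_uStar {k n : ℕ} (hk : 3 ≤ k) : (uStar k n hk).IsUnicyclic k :=
  isUnicyclic_attach_twoCycle hk (b := fun _ => 0) fun _ => rfl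

theorem isUnicyclic_hyperF {k n : ℕ} (hk : 3 ≤ k) : (hyperF k n hk).IsUnicyclic k :=
  isUnicyclic_attach_twoCycle hk (b := Sum.elim (fun _ => 0) fun _ => 1) (by rintro (j | j) <;> rfl)

theorem card_edges_uStar {k n : ℕ} (hk : 3 ≤ k) (hn : 2 ≤ n / (k - 1)) :
    (uStar k n hk).edges.card = n / (k - 1) := by
  rw [uStar, card_edges_attach_twoCycle, Fintype.card_fin]
  omega

theorem card_edges_hyperF {k n : ℕ} (hk : 3 ≤ k) (hn : 3 ≤ n / (k - 1)) :
    (hyperF k n hk).edges.card = n / (k - 1) := by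
  rw [hyperF, card_edges_attach_twoCycle, Fintype.card_sum, Fintype.card_fin, Fintype.card_fin]
  omega

end FinHypergraph

theorem theorem1p2 (k n : ℕ) (hk : 3 ≤ k) :
    (∀ (V : Type*) [Fintype V] [DecidableEq V] (G : FinHypergraph V), G.MemLambda k n hk →
      G.rho ≤ (FinHypergraph.hyperF k n hk).rho ∧
      (G.rho = (FinHypergraph.hyperF k n hk).rho ↔
        G.Isomorphic (FinHypergraph.hyperF k n hk))) ∧
    ((k - 1) ∣ n → 4 ≤ n / (k - 1) →
      (FinHypergraph.hyperF k n hk).MemLambda k n hk ∧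
      (FinHypergraph.uStar k n hk).IsUnicyclic k ∧
      Fintype.card ((Fin 2 ⊕ Fin 2 × Fin (k - 2)) ⊕ Fin (n / (k - 1) - 2) × Fin (k - 1)) = n ∧
      (FinHypergraph.hyperF k n hk).rho < (FinHypergraph.uStar k n hk).rho) := by
  refine ⟨fun V _ _ G hG => ?_, fun hdvd hm => ?_⟩
  · obtain ⟨hGu, hn, hm, hU⟩ := hG
    rcases hGu.rho_lt_hyperF_or_isomorphic hk hn (by omega) hU with hlt | hiso
    · exact ⟨hlt.le, fun h => absurd h hlt.ne, fun h => h.rho_eq⟩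
    · exact ⟨hiso.rho_eq.le, fun _ => hiso, fun h => h.rho_eq⟩
  · have hFcard : (FinHypergraph.hyperF k n hk).edges.card = n / (k - 1) :=
      FinHypergraph.card_edges_hyperF hk (by omega)
    have hFn := (FinHypergraph.isUnicyclic_hyperF (n := n) hk).card_eq (by omega)
    rw [hFcard, Nat.mul_div_cancel' hdvd] at hFn
    have hUn := (FinHypergraph.isUnicyclic_uStar (n := n) hk).card_eq (by omega)
    rw [FinHypergraph.card_edges_uStar hk (by omega), Nat.mul_div_cancel' hdvd] at hUn
    have hFU : ¬ (FinHypergraph.hyperF k n hk).Isomorphic (FinHypergraph.uStar k n hk) :=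
      fun h => FinHypergraph.not_exists_mem_hyperF hk hm
        (h.exists_mem_of_exists_mem (FinHypergraph.exists_mem_uStar hk))
    exact ⟨⟨FinHypergraph.isUnicyclic_hyperF hk, hFn, by omega, hFU⟩,
      FinHypergraph.isUnicyclic_uStar hk, hUn,
      ((FinHypergraph.isUnicyclic_hyperF hk).rho_lt_uStar_or_isomorphic hk hFn).resolve_right hFU⟩
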